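/- Let $M=(\mathcal S,\mathcal A,p,\nu)$ be an MDP with finite state space $\mathcal S$, $|\mathcal S|=S$, and finite action space $\mathcal A$, where $p(\cdot\mid s,a)$ is the transition law and $\nu(s,a)$ is the reward distribution on $[0,1]$, with mean $\mu(s,a)$. A learner interacts with $M$: at step $n$ it is in state $s_n$ and chooses an action $a_n$ from its past observations (possibly with additional randomization); given everything determined up to the choice of $a_n$, the reward $r_n\sim\nu(s_n,a_n)$ and the next state $s_{n+1}\sim p(\cdot\mid s_n,a_n)$ are drawn independently. A *profile* of $q:\mathcal S\to\mathbb R$ is a bijection $\sigma:\{1,\dots,S\}\to\mathcal S$ with $q(\sigma(1))\ge\dots\ge q(\sigma(S))$. Let $\mathcal C$ be the partition of $\mathcal S\times\mathcal A$ into the classes of the following equivalence relation: two pairs $(s,a),(s',a')$ are equivalent if $p(\sigma_{s,a}(i)\mid s,a)=p(\sigma_{s',a'}(i)\mid s',a')$ for all $i$, where $\sigma_{s,a},\sigma_{s',a'}$ are profiles of the two transition laws, and $\mu(s,a)=\mu(s',a')$. Put $C=|\mathcal C|$. For $t\ge 0$ let $N_t(s,a)$ be the number of observations of $(s,a)$ in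 the first $t$ steps, $n_t(c)=\sum_{(s,a)\in c}N_t(s,a)$, and let $\widehat p_t(\cdot\mid s,a)$ be the empirical distribution of the states that followed $(s,a)$ in these steps. Let $\sigma_{s,a,t}$ be any profile of $\widehat p_t(\cdot\mid s,a)$ (ties broken arbitrarily) and, for $c\in\mathcal C$ with $n_t(c)>0$, let $$\widehat p_t^{\,\boldsymbol\sigma_t}(i\mid c)=\frac1{n_t(c)}\sum_{(s,a)\in c}N_t(s,a)\,\widehat p_t(\sigma_{s,a,t}(i)\mid s,a),\qquad 1\le i\le S.$$ For $n\ge1$ and $\delta>0$ let $$\mathbb W_n(\delta)=\sqrt{\frac{2\left(1+\frac1n\right)\log\left(\sqrt{n+1}\,\frac{2^S-2}{\delta}\right)}{n}}$$ (with $\mathbb W_n(\delta)=0$ if $S=1$; pairs with $N_t(s,a)=0$ contribute $0$ to the sum below). For $\delta\in(0,1)$ the confidence set $\mathsf{CB}_{t,\delta}(\mathcal C)$ consists of all transition functions $p'$ such that for every $c\in\mathcal C$ the laws $p'(\cdot\mid s,a)$, $(s,a)\in c$, have the same non-increasing rearrangement $p'(1\mid c)\ge\dots\ge p'(S\mid c)$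 and, if $n_t(c)>0$, $$\sum_{i=1}^{S}\left|\widehat p_t^{\,\boldsymbol\sigma_t}(i\mid c)-p'(i\mid c)\right|\;\le\;\frac1{n_t(c)}\sum_{(s,a)\in c}N_t(s,a)\,\mathbb W_{N_t(s,a)}\!\left(\frac{\delta}{C}\right).$$ Then, whatever the learner does, for every $\delta\in(0,1)$, $$\mathbb P\left(\forall t\ge 0:\ p\in\mathsf{CB}_{t,\delta}(\mathcal C)\right)\ \ge\ 1-\delta .$$ -/

import Mathlib

open MeasureTheory

namespace EquivRL

/-- A finite Markov decision process with state space `S` and action space `A`: a transition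
function `p` and a reward distribution function `ν` on `[0, 1]`. Pairs `(s, a)` are elements of
`S × A`, and `p (s, a) x` is the probability to move from `s` to `x` under the action `a`. -/
structure MDP (S A : Type*) [Fintype S] where
  p : S × A → stdSimplex ℝ S
  ν : S × A → Measure ℝ
  prob : ∀ z, IsProbabilityMeasure (ν z)
  supp : ∀ z, ν z (Set.Icc (0 : ℝ) 1)ᶜ = 0

/-- The mean reward of a pair. -/
noncomputable def MDP.mean {S A : Type*} [Fintype S] (M : MDP S A) (z : S × A) : ℝ :=
  ∫ x, x ∂(M.ν z)

/-- `σ` is a profile (mapping) of `q`: it enumerates the states so that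
`q (σ 1) ≥ q (σ 2) ≥ ⋯ ≥ q (σ |S|)` (indices start at `0` here). -/
def IsProfile {S : Type*} [Fintype S] (q : S → ℝ) (σ : Fin (Fintype.card S) ≃ S) : Prop :=
  Antitone fun i => q (σ i)

theorem exists_isProfile {S : Type*} [Fintype S] (q : S → ℝ) : ∃ σ, IsProfile q σ := by
  let e : Fin (Fintype.card S) ≃ S := (Fintype.equivFin S).symm
  let f : Fin (Fintype.card S) → ℝ := fun i => - q (e i)
  refine ⟨(Tuple.sort f).trans e, fun i j hij => ?_⟩
  have h := Tuple.monotone_sort f hij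
  simp only [Function.comp, f] at h
  simpa using h

theorem IsProfile.unique {S : Type*} [Fintype S] {q : S → ℝ}
    {σ τ : Fin (Fintype.card S) ≃ S} (hσ : IsProfile q σ) (hτ : IsProfile q τ)
    (i : Fin (Fintype.card S)) : q (σ i) = q (τ i) := by
  let f : Fin (Fintype.card S) → ℝ := fun i => - q (σ i)
  have h1 : Monotone (f ∘ (1 : Equiv.Perm (Fin (Fintype.card S)))) := fun i j hij => by
    simpa [f] using hσ hij
  have h2 : Monotone (f ∘ (τ.trans σ.symm : Equiv.Perm (Fin (Fintype.card S)))) :=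
    fun i j hij => by simpa [f] using hτ hij
  have h := congrFun (Tuple.unique_monotone h1 h2) i
  simpa [f] using h

/-- `(ε₁, ε₂)`-similarity of two pairs: the transition laws, each ordered by a profile, are at
`ℓ¹` distance at most `ε₁`, and the mean rewards differ by at most `ε₂`. -/
def MDP.Similar {S A : Type*} [Fintype S] (M : MDP S A) (ε₁ ε₂ : ℝ) (z z' : S × A) : Prop :=
  (∀ σ τ, IsProfile (M.p z) σ → IsProfile (M.p z') τ →
    ∑ i, |M.p z (σ i) - M.p z' (τ i)| ≤ ε₁) ∧ |M.mean z - M.mean z'| ≤ ε₂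

/-- `(0, 0)`-similarity, an equivalence relation on the pairs. -/
def MDP.setoid {S A : Type*} [Fintype S] (M : MDP S A) : Setoid (S × A) where
  r := M.Similar 0 0
  iseqv :=
    { refl := fun z => ⟨fun σ τ hσ hτ => by simp [hσ.unique hτ], by simp⟩
      symm := fun {z z'} h => ⟨fun σ τ hσ hτ => by
          simpa only [abs_sub_comm] using h.1 τ σ hτ hσ, by
          simpa only [abs_sub_comm] using h.2⟩
      trans := fun {x y z} hxy hyz => by
        obtain ⟨ρ, hρ⟩ := exists_isProfile (M.p y)
        refine ⟨fun σ τ hσ hτ => ?_, ?_⟩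
        · refine (Finset.sum_le_sum fun i _ =>
            abs_sub_le (M.p x (σ i)) (M.p y (ρ i)) (M.p z (τ i))).trans ?_
          rw [Finset.sum_add_distrib]
          linarith [hxy.1 σ ρ hσ hρ, hyz.1 ρ τ hρ hτ]
        · linarith [abs_sub_le (M.mean x) (M.mean y) (M.mean z), hxy.2, hyz.2] }

/-- The equivalence structure of the MDP: the partition of the pairs into the classes of
`(0, 0)`-similarity. -/
noncomputable def MDP.classes {S A : Type*} [Fintype S] [Fintype A] [DecidableEq S]
    [DecidableEq A] (M : MDP S A) : Finpartition (Finset.univ : Finset (S × A)) :=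
  letI : DecidableRel M.setoid.r := Classical.decRel _
  Finpartition.ofSetoid M.setoid

/-- The learner interacts with `M`. Step `n` is played in the state `s n` with the action `a n`,
then yields the reward `r n` and the next state `s (n + 1)` (step `0` is the first one).
The σ-algebra `ℱ n` holds what is determined once the action `a n` is chosen: all the earlier
states, actions and rewards, the current state and action, and whatever else the learner used to
choose its actions, such as internal randomization. Given `ℱ n`, the reward and the next state
are independently drawn from `ν (s n, a n)` and `p (s n, a n)`. -/
structure IsInteraction {S A Ω : Type*} [Fintype S] [MeasurableSpace S] [MeasurableSpace A]
    {mΩ : MeasurableSpace Ω} (M : MDP S A) (P : Measure Ω) (ℱ : Filtration ℕ mΩ)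
    (s : ℕ → Ω → S) (a : ℕ → Ω → A) (r : ℕ → Ω → ℝ) : Prop where
  state_meas : ∀ n, Measurable[ℱ n] (s n)
  action_meas : ∀ n, Measurable[ℱ n] (a n)
  reward_meas : ∀ n, Measurable[ℱ (n + 1)] (r n)
  law : ∀ n (x : S) (B : Set ℝ), MeasurableSet B →
    P[Set.indicator {ω | r n ω ∈ B ∧ s (n + 1) ω = x} (fun _ => (1 : ℝ)) | ℱ n] =ᵐ[P]
      fun ω => (M.ν (s n ω, a n ω)).real B * M.p (s n ω, a n ω) x

/-- `N_t(z)`: the number of observations of the pair `z` in the first `t` steps of a trajectory. -/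
def count {S A : Type*} [DecidableEq S] [DecidableEq A] (s : ℕ → S) (a : ℕ → A) (t : ℕ)
    (z : S × A) : ℕ :=
  ((Finset.range t).filter fun n => (s n, a n) = z).card

/-- `p̂_t(x | z)`: the empirical distribution of the state that follows the pair `z` in the first
`t` steps (zero if `z` was not observed; it then always carries the weight `N_t(z) = 0`). -/
noncomputable def empDist {S A : Type*} [DecidableEq S] [DecidableEq A] (s : ℕ → S) (a : ℕ → A)
    (t : ℕ) (z : S × A) (x : S) : ℝ :=
  (((Finset.range t).filter fun n => (s n, a n) = z ∧ s (n + 1) = x).card : ℝ) / count s a t z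

/-- `n_t(c)`: the number of observations of pairs of `c` in the first `t` steps. -/
def classCount {S A : Type*} [DecidableEq S] [DecidableEq A] (s : ℕ → S) (a : ℕ → A) (t : ℕ)
    (c : Finset (S × A)) : ℕ :=
  ∑ z ∈ c, count s a t z

/-- The aggregated empirical distribution of the class `c`, where the empirical distribution of
each pair `z` is ordered by `σ z` before averaging with the weights `N_t(z) / n_t(c)`. -/
noncomputable def aggDist {S A : Type*} [Fintype S] [DecidableEq S] [DecidableEq A]
    (s : ℕ → S) (a : ℕ → A) (t : ℕ) (σ : S × A → (Fin (Fintype.card S) ≃ S))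
    (c : Finset (S × A)) (i : Fin (Fintype.card S)) : ℝ :=
  1 / (classCount s a t c : ℝ) * ∑ z ∈ c, (count s a t z : ℝ) * empDist s a t z (σ z i)

/-- The radius of the time-uniform Weissman bound for `k` states, `n` observations and level
`δ`. -/
noncomputable def weissman (k n : ℕ) (δ : ℝ) : ℝ :=
  √(2 * (1 + 1 / (n : ℝ)) * Real.log (√((n : ℝ) + 1) * ((2 ^ k - 2) / δ)) / n)

/-- The sample-weighted average over the pairs of `c` of their Weissman radii at level `δ`. -/
noncomputable def radius {S A : Type*} [Fintype S] [DecidableEq S] [DecidableEq A]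
    (s : ℕ → S) (a : ℕ → A) (t : ℕ) (c : Finset (S × A)) (δ : ℝ) : ℝ :=
  1 / (classCount s a t c : ℝ) *
    ∑ z ∈ c, (count s a t z : ℝ) * weissman (Fintype.card S) (count s a t z) δ

/-- The confidence set at time `t` built from the classes `𝒞` and the (empirical) profiles `σ`:
all transition functions `q` that have on each class `c` a common ordered law `g` (this is
`q(· | c)`, in the coordinates given by the profiles) which lies within the radius, at level
`δ / |𝒞|`, of the aggregated ordered empirical distribution of `c`. A class without
observations puts no constraint on its law. -/
def confSet {S A : Type*} [Fintype S] [Fintype A] [DecidableEq S] [DecidableEq A]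
    (𝒞 : Finpartition (Finset.univ : Finset (S × A))) (s : ℕ → S) (a : ℕ → A)
    (σ : S × A → (Fin (Fintype.card S) ≃ S)) (t : ℕ) (δ : ℝ) :
    Set (S × A → stdSimplex ℝ S) :=
  {q | ∀ c ∈ 𝒞.parts, ∃ g : Fin (Fintype.card S) → ℝ,
    (∀ z ∈ c, ∀ τ, IsProfile (q z) τ → ∀ i, q z (τ i) = g i) ∧
    (0 < classCount s a t c →
      ∑ i, |aggDist s a t σ c i - g i| ≤ radius s a t c (δ / (𝒞.parts.card : ℝ)))}

end EquivRL

namespace EquivRL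

/-! ### Hyperbolic functions -/

/-! Sorting is nonexpansive in ℓ¹, so the error of a class is at most the average of the unsorted
errors of its pairs. It therefore suffices that, for each class, the sum over its pairs of `excess`
(total variation deviation minus half of N times the Weissman radius) ever becomes positive with
probability at most δ/C. Every pair uses the level δ/C, so a union bound over the pairs of a class
is not affordable: the class needs one supermartingale that reaches C/δ as soon as the summed excess
is positive.

For one pair and a fixed tilt u, the average over the 2^S - 2 nonempty proper events B of exp(u
dev(B) - u²N/8) is a supermartingale by Hoeffding's lemma (`tilt`). `mix` spreads the tilt: weight
2/3 at l, and weight 1/3 on l times a Pareto variable. The product over the pairs of a class is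
still a supermartingale, because one step changes one factor. `potential` integrates this product
over l with a half-normal weight.

The key estimate is `exp_excess_le_mix`: for every l up to `maxTilt`, the mixture of a pair
dominates exp(l · excess), whatever its deviation. Given this, let z be the most observed pair of
the class. The cap `maxTilt` decreases in the number of observations, so the cap of z is valid for
all pairs. If the total excess is positive, the other factors multiply to at least exp(-l ·
excess(z)). Multiplied by the largest term of the atom of z, this cancels the random deviation of z.
A deterministic Gaussian integral in l remains, which is at least C/δ (`exp_le_potential`). Ville's
inequality and a union bound over the classes conclude.

For the key estimate, tilts are measured in units of √(8/n). The target becomes exp(ε(m - 2√Q)),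
with Q = K(n+1)/n, K = ½ log(n+1) + A + L and A = log(2^S - 2). Two minorants of the supermartingale
are used: keeping the best event gives exp(μm - A - μ²), good near the optimal tilt √Q; keeping all
events gives a product of cosh, hence exp(d log cosh(μm/d) - μ²), which does not lose A and is good
for small tilts. If ε is near or above √Q, the atom suffices. If ε is small and m ≥ 2√Q, the Pareto
part reaches tilts near √Q, where the supermartingale is large. If ε is small and m ≤ 2√Q, either
the atom suffices or the Pareto part gains from cosh growing faster than the Gaussian factor. -/

theorem le_sinh_mul_cosh {x : ℝ} (hx : 0 ≤ x) : x ≤ Real.sinh x * Real.cosh x := by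
  have h1 : x ≤ Real.sinh x := Real.self_le_sinh_iff.2 hx
  have h2 : 1 ≤ Real.cosh x := Real.one_le_cosh x
  nlinarith

theorem hasDerivAt_tanh (x : ℝ) : HasDerivAt Real.tanh (1 / Real.cosh x ^ 2) x := by
  have h : HasDerivAt (fun y => Real.sinh y / Real.cosh y)
      ((Real.cosh x * Real.cosh x - Real.sinh x * Real.sinh x) / Real.cosh x ^ 2) x :=
    (Real.hasDerivAt_sinh x).div (Real.hasDerivAt_cosh x) (Real.cosh_pos x).ne'
  have e : Real.tanh = fun y => Real.sinh y / Real.cosh y := by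
    funext y; exact Real.tanh_eq_sinh_div_cosh y
  rw [e]
  convert h using 1
  have := Real.cosh_sq x
  congr 1
  nlinarith

/-- The derivative has the sign of x - sinh x cosh x. Up to a factor 2, this quotient at √t is the
derivative of log cosh √t. -/
theorem antitoneOn_tanh_div : AntitoneOn (fun x => Real.tanh x / x) (Set.Ioi 0) := by
  have hd : ∀ x ∈ Set.Ioi (0 : ℝ), HasDerivAt (fun x => Real.tanh x / x)
      ((1 / Real.cosh x ^ 2 * x - Real.tanh x * 1) / x ^ 2) x := fun x hx =>
    (hasDerivAt_tanh x).div (hasDerivAt_id x) (ne_of_gt hx)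
  apply antitoneOn_of_deriv_nonpos (convex_Ioi 0)
  · exact fun x hx => (hd x hx).continuousAt.continuousWithinAt
  · rw [interior_Ioi]
    exact fun x hx => (hd x hx).differentiableAt.differentiableWithinAt
  · rw [interior_Ioi]
    intro x hx
    rw [(hd x hx).deriv]
    have hx' : (0 : ℝ) < x := hx
    apply div_nonpos_of_nonpos_of_nonneg _ (by positivity)
    have hc := Real.cosh_pos x
    rw [Real.tanh_eq_sinh_div_cosh]
    have := le_sinh_mul_cosh hx'.le
    rw [sub_nonpos, one_div, mul_one, inv_mul_le_iff₀ (by positivity)]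
    calc x ≤ Real.sinh x * Real.cosh x := this
      _ = _ := by field_simp

/-- `t ↦ log (cosh √t)` is concave. -/
theorem concaveOn_log_cosh_sqrt :
    ConcaveOn ℝ (Set.Ici 0) (fun t => Real.log (Real.cosh √t)) := by
  have hd : ∀ t ∈ Set.Ioi (0 : ℝ), HasDerivAt (fun t => Real.log (Real.cosh √t))
      (Real.tanh √t / √t / 2) t := by
    intro t ht
    have h := ((Real.hasDerivAt_cosh √t).comp t
      (Real.hasDerivAt_sqrt (ne_of_gt ht))).log (Real.cosh_pos _).ne'
    refine HasDerivAt.congr_deriv h ?_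
    rw [Real.tanh_eq_sinh_div_cosh]
    have : √t ≠ 0 := (Real.sqrt_pos.2 ht).ne'
    have := (Real.cosh_pos √t).ne'
    simp only [Function.comp]
    field_simp
  apply AntitoneOn.concaveOn_of_deriv (convex_Ici 0)
  · exact (Continuous.log (Real.continuous_cosh.comp Real.continuous_sqrt)
      fun x => (Real.cosh_pos _).ne').continuousOn
  · rw [interior_Ici]
    exact fun x hx => (hd x hx).differentiableAt.differentiableWithinAt
  · rw [interior_Ici]
    intro x hx y hy hxy
    rw [(hd x hx).deriv, (hd y hy).deriv]
    have := antitoneOn_tanh_div (a := √x) (b := √y) (Real.sqrt_pos.2 hx) (Real.sqrt_pos.2 hy)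
      (Real.sqrt_le_sqrt hxy)
    simp only at this
    linarith

theorem sub_log_two_le_log_cosh (x : ℝ) : x - Real.log 2 ≤ Real.log (Real.cosh x) := by
  rw [Real.le_log_iff_exp_le (Real.cosh_pos x), Real.exp_sub, Real.exp_log (by norm_num),
    Real.cosh_eq]
  have := Real.exp_pos (-x)
  linarith

/-- If a function of the form `d log cosh (c μ) - μ²` is at least `ℓ` at `a` and `b`, then it is
so in between. -/
theorem le_log_cosh_sub_sq {d c a b μ ℓ : ℝ} (hd : 0 ≤ d) (hc : 0 ≤ c) (h0 : 0 ≤ a)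
    (ha : ℓ ≤ d * Real.log (Real.cosh (c * a)) - a ^ 2)
    (hb : ℓ ≤ d * Real.log (Real.cosh (c * b)) - b ^ 2) (h1 : a ≤ μ) (h2 : μ ≤ b) :
    ℓ ≤ d * Real.log (Real.cosh (c * μ)) - μ ^ 2 := by
  have key : ∀ x, 0 ≤ x → Real.log (Real.cosh (c * x)) = Real.log (Real.cosh √(c ^ 2 * x ^ 2)) := by
    intro x hx
    rw [← mul_pow, Real.sqrt_sq (by positivity)]
  rcases eq_or_lt_of_le (h1.trans h2) with hab | hab
  · have : μ = a := le_antisymm (h2.trans hab.ge) h1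
    rwa [this]
  have hb0 : 0 ≤ b := h0.trans hab.le
  have hμ0 : 0 ≤ μ := h0.trans h1
  have hs : 0 < b ^ 2 - a ^ 2 := by nlinarith
  -- Barycentric coordinate of μ² between a² and b²: in the variable μ² the log cosh term is concave
  -- and the subtracted term is linear.
  set s : ℝ := (b ^ 2 - μ ^ 2) / (b ^ 2 - a ^ 2) with hsdef
  have hs0 : 0 ≤ s := div_nonneg (by nlinarith) hs.le
  have hs1 : 0 ≤ 1 - s := by
    rw [sub_nonneg, hsdef, div_le_one hs]; nlinarith
  have hconv : s * a ^ 2 + (1 - s) * b ^ 2 = μ ^ 2 := by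
    rw [hsdef]; field_simp; ring
  have hcc := concaveOn_log_cosh_sqrt.2 (x := c ^ 2 * a ^ 2) (y := c ^ 2 * b ^ 2)
    (Set.mem_Ici.2 (by positivity)) (Set.mem_Ici.2 (by positivity)) hs0 hs1 (by ring)
  simp only [smul_eq_mul] at hcc
  have e : s * (c ^ 2 * a ^ 2) + (1 - s) * (c ^ 2 * b ^ 2) = c ^ 2 * μ ^ 2 := by
    rw [← hconv]; ring
  rw [e, ← key a h0, ← key b hb0, ← key μ hμ0] at hcc
  have := mul_le_mul_of_nonneg_left hcc hd
  nlinarith [mul_le_mul_of_nonneg_left ha hs0, mul_le_mul_of_nonneg_left hb hs1]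

/-! ### Mixtures -/

/-- The mixture of a function with weight `2 / 3` at `x` and with weight `1 / 3` for a Pareto
distributed multiple of `x`. -/
noncomputable def mix (E : ℝ → ℝ) (x : ℝ) : ENNReal :=
  ENNReal.ofReal (2 / 3 * E x) + ∫⁻ t in Set.Ioi (1 : ℝ), ENNReal.ofReal (1 / 3 / t ^ 2 * E (x * t))

theorem ofReal_integral_le {μ : Measure ℝ} {f : ℝ → ℝ} (hf : Integrable f μ) :
    ENNReal.ofReal (∫ x, f x ∂μ) ≤ ∫⁻ x, ENNReal.ofReal (f x) ∂μ := by
  have h := ofReal_integral_eq_lintegral_ofReal hf.pos_part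
    (Filter.Eventually.of_forall fun x => le_max_right _ _)
  calc ENNReal.ofReal (∫ x, f x ∂μ) ≤ ENNReal.ofReal (∫ x, max (f x) 0 ∂μ) :=
        ENNReal.ofReal_le_ofReal (integral_mono hf hf.pos_part fun x => le_max_left _ _)
    _ = ∫⁻ x, ENNReal.ofReal (max (f x) 0) ∂μ := h
    _ = _ := by
      refine lintegral_congr fun x => ?_
      rcases le_total (f x) 0 with h | h
      · rw [max_eq_right h, ENNReal.ofReal_zero, ENNReal.ofReal_of_nonpos h]
      · rw [max_eq_left h]

/-- An explicit minorant with known antiderivative bounds the Lebesgue integral from below, so the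
true integrand needs neither continuity nor integrability. -/
theorem ofReal_sub_le_lintegral {F f h : ℝ → ℝ} {a b : ℝ} (hab : a ≤ b)
    (hF : ∀ t ∈ Set.Icc a b, HasDerivAt F (f t) t) (hf : ContinuousOn f (Set.Icc a b))
    (hle : ∀ t ∈ Set.Icc a b, f t ≤ h t) :
    ENNReal.ofReal (F b - F a) ≤ ∫⁻ t in Set.Ioc a b, ENNReal.ofReal (h t) := by
  have hi : IntervalIntegrable f volume a b :=
    ContinuousOn.intervalIntegrable (by rwa [Set.uIcc_of_le hab])
  have h1 : ∫ t in a..b, f t = F b - F a :=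
    intervalIntegral.integral_eq_sub_of_hasDerivAt (by rwa [Set.uIcc_of_le hab]) hi
  rw [← h1, intervalIntegral.integral_of_le hab]
  refine (ofReal_integral_le hi.1).trans ?_
  refine setLIntegral_mono' measurableSet_Ioc fun t ht => ?_
  exact ENNReal.ofReal_le_ofReal (hle t ⟨ht.1.le, ht.2⟩)

theorem le_mix_of_le {E : ℝ → ℝ} {x r : ℝ} (h : r ≤ 2 / 3 * E x) :
    ENNReal.ofReal r ≤ mix E x :=
  (ENNReal.ofReal_le_ofReal h).trans le_self_add

/-- A lower bound for a mixture by integrals over two consecutive intervals. -/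
theorem le_mix_of_le_integrals {E F f F' f' : ℝ → ℝ} {x b c r₀ r : ℝ} (hb : 1 ≤ b) (hbc : b ≤ c)
    (h0 : r₀ ≤ 2 / 3 * E x)
    (hF : ∀ t ∈ Set.Icc 1 b, HasDerivAt F (f t) t) (hf : ContinuousOn f (Set.Icc 1 b))
    (hle : ∀ t ∈ Set.Icc 1 b, f t ≤ 1 / 3 / t ^ 2 * E (x * t))
    (hF' : ∀ t ∈ Set.Icc b c, HasDerivAt F' (f' t) t) (hf' : ContinuousOn f' (Set.Icc b c))
    (hle' : ∀ t ∈ Set.Icc b c, f' t ≤ 1 / 3 / t ^ 2 * E (x * t))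
    (hr : r ≤ r₀ + (F b - F 1) + (F' c - F' b)) :
    ENNReal.ofReal r ≤ mix E x := by
  have h1 := ofReal_sub_le_lintegral hb hF hf hle
  have h2 := ofReal_sub_le_lintegral hbc hF' hf' hle'
  refine (ENNReal.ofReal_le_ofReal hr).trans ?_
  refine ENNReal.ofReal_add_le.trans ?_
  refine (add_le_add ENNReal.ofReal_add_le le_rfl).trans ?_
  rw [mix, add_assoc]
  refine add_le_add (ENNReal.ofReal_le_ofReal h0) ?_
  refine (add_le_add h1 h2).trans ?_
  rw [← lintegral_union measurableSet_Ioc (Set.Ioc_disjoint_Ioc_of_le le_rfl),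
    Set.Ioc_union_Ioc_eq_Ioc hb hbc]
  exact lintegral_mono_set Set.Ioc_subset_Ioi_self

/-! ### Tilts near the optimum, and large deviations -/

theorem three_halves_le_exp : (3 : ℝ) / 2 ≤ Real.exp 0.4055 := by
  refine le_trans ?_ (Real.sum_le_exp_of_nonneg (by norm_num) 6)
  norm_num [Finset.sum_range_succ, Nat.factorial]

/-- The weight 2/3 of the atom costs log(3/2) < 0.4055 in the exponent. -/
theorem exp_le_two_thirds_mul {x y e : ℝ} (h : x + 0.4055 ≤ y) (he : Real.exp y ≤ e) :
    Real.exp x ≤ 2 / 3 * e := by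
  have h1 : Real.exp x * Real.exp 0.4055 ≤ Real.exp y := by
    rw [← Real.exp_add]; exact Real.exp_le_exp.2 h
  have := mul_le_mul_of_nonneg_left three_halves_le_exp (Real.exp_pos x).le
  linarith

/-- Exponential tilts near the optimal one beat the target by a constant factor. -/
theorem exp_le_mix_of_near {E : ℝ → ℝ} {A Q ε m : ℝ} (hε : 0 < ε) (hQ : 0 ≤ Q)
    (hJ : ∀ μ, 0 < μ → Real.exp (μ * m - A - μ ^ 2) ≤ E μ)
    (h : (√Q - ε) ^ 2 ≤ Q - A - 0.4055) :
    ENNReal.ofReal (Real.exp (ε * (m - 2 * √Q))) ≤ mix E ε := by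
  refine le_mix_of_le (exp_le_two_thirds_mul ?_ (hJ ε hε))
  have := Real.sq_sqrt hQ
  nlinarith

theorem log_cosh_le_log_cosh {x y : ℝ} (hx : 0 ≤ x) (hxy : x ≤ y) :
    Real.log (Real.cosh x) ≤ Real.log (Real.cosh y) :=
  Real.log_le_log (Real.cosh_pos x)
    (Real.cosh_le_cosh.2 (by rwa [abs_of_nonneg hx, abs_of_nonneg (hx.trans hxy)]))

/-- By concavity in μ² only the endpoints matter. Both sides vanish at 0, and at √Q the bound log
cosh x ≥ x - log 2 leaves 2Q - d log 2 ≥ Q. -/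
theorem sq_le_mul_log_cosh {d Q μ : ℝ} (hd : 0 < d) (hQ : d * Real.log 2 ≤ Q) (hμ : 0 ≤ μ)
    (hμQ : μ ≤ √Q) : μ ^ 2 ≤ d * Real.log (Real.cosh (2 * √Q / d * μ)) := by
  have hQ0 : 0 ≤ Q := le_trans (by positivity) hQ
  have h := le_log_cosh_sub_sq (d := d) (c := 2 * √Q / d) (a := 0) (b := √Q) (μ := μ) (ℓ := 0)
    hd.le (by positivity) le_rfl (by simp) ?_ hμ hμQ
  · linarith
  · have h1 := sub_log_two_le_log_cosh (2 * √Q / d * √Q)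
    have h2 := mul_le_mul_of_nonneg_left h1 hd.le
    have h3 : 2 * √Q / d * √Q = 2 * Q / d := by
      have := Real.mul_self_sqrt hQ0
      field_simp
      linarith
    rw [h3] at h2 ⊢
    have h4 : d * (2 * Q / d - Real.log 2) = 2 * Q - d * Real.log 2 := by field_simp
    rw [Real.sq_sqrt hQ0]
    linarith

/-- Once the deviation reaches its threshold, the bound by all events keeps the full initial mass at
every tilt up to √Q; the bound by a single event would lose A at small tilts. -/
theorem one_le_of_log_cosh_le {E : ℝ → ℝ} {d Q m μ : ℝ} (hd : 0 < d) (hQ : d * Real.log 2 ≤ Q)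
    (hC : ∀ μ, 0 < μ → Real.exp (d * Real.log (Real.cosh (μ * m / d)) - μ ^ 2) ≤ E μ)
    (hm : 2 * √Q ≤ m) (hμ : 0 < μ) (hμQ : μ ≤ √Q) : 1 ≤ E μ := by
  refine le_trans ?_ (hC μ hμ)
  rw [Real.one_le_exp_iff, sub_nonneg]
  refine (sq_le_mul_log_cosh hd hQ hμ.le hμQ).trans ?_
  refine mul_le_mul_of_nonneg_left (log_cosh_le_log_cosh (by positivity) ?_) hd.le
  rw [div_mul_eq_mul_div]
  refine div_le_div_of_nonneg_right ?_ hd.le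
  nlinarith

/-- Lower bound in the window of the large tilts. -/
theorem window_le {A Q ε m t : ℝ} (hε : 0 < ε) (hQ : 0 ≤ Q) (hm : 2 * √Q ≤ m)
    (hw : 1.26 ≤ √Q) (ht1 : 1 ≤ t) (h1 : √Q - 0.84 ≤ ε * t) (h2 : ε * t ≤ √Q + 0.84) :
    1 / 3 * Real.exp (Q - A - 0.2352) * (1.2352 - (ε * t - √Q) ^ 2) *
      (ε ^ 2 / Q * (1 - 2 / √Q * (ε * t - √Q)) +
        (Real.exp (ε * (m - 2 * √Q)) - 1) / √Q * ε * (1 - 1 / √Q * (ε * t - √Q))) ≤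
    1 / 3 / t ^ 2 * Real.exp (ε * t * m - A - (ε * t) ^ 2) := by
  set q := √Q with hq
  have hqq : q ^ 2 = Q := Real.sq_sqrt hQ
  set H := Real.exp (ε * (m - 2 * q)) - 1 with hH
  have hH0 : 0 ≤ H := by
    rw [hH, sub_nonneg, Real.one_le_exp_iff]
    exact mul_nonneg hε.le (by linarith)
  set θ := ε * t - q with hθ
  have ht0 : 0 < t := by linarith
  have hq0 : 0 < q := by linarith
  have hεt : ε * t = q + θ := by rw [hθ]; ring
  have hθ1 : -0.84 ≤ θ := by linarith
  have hθ2 : θ ≤ 0.84 := by linarith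
  have e1 : Real.exp (ε * t * m - A - (ε * t) ^ 2) =
      Real.exp (Q - A - 0.2352) * Real.exp (0.2352 - θ ^ 2) *
        Real.exp (ε * (m - 2 * q)) ^ t := by
    rw [← Real.exp_mul, ← Real.exp_add, ← Real.exp_add]
    congr 1
    have : ε * (m - 2 * q) * t = (q + θ) * (m - 2 * q) := by rw [← hεt]; ring
    rw [this, hεt, ← hqq]
    ring
  -- 0.2352 = 0.84²/3 is the mean of θ² over |θ| ≤ 0.84, so the tangent of exp at 0 leaves a
  -- minorant whose integral over the window is exactly its length 1.68.
  have b1 : 1.2352 - θ ^ 2 ≤ Real.exp (0.2352 - θ ^ 2) := by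
    have := Real.add_one_le_exp (0.2352 - θ ^ 2)
    linarith
  -- Bernoulli's inequality makes the bound affine in H, to be compared with the target 1 + H.
  have b2 : 1 + t * H ≤ Real.exp (ε * (m - 2 * q)) ^ t := by
    have := one_add_mul_self_le_rpow_one_add (s := H) (by linarith) ht1
    rwa [show 1 + H = Real.exp (ε * (m - 2 * q)) by rw [hH]; ring] at this
  have b0 : 0 ≤ 1.2352 - θ ^ 2 := by nlinarith
  -- Here and in `b4`, 1/t² and 1/t are replaced by their tangents at θ = 0. The linear terms are
  -- odd in θ and integrate to zero over the symmetric window.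
  have b3 : ε ^ 2 / Q * (1 - 2 / q * θ) ≤ 1 / t ^ 2 := by
    rw [le_div_iff₀ (by positivity), ← hqq]
    have e : ε ^ 2 / q ^ 2 * (1 - 2 / q * θ) * t ^ 2 = (1 - 2 * (θ / q)) * (1 + θ / q) ^ 2 := by
      have : ε ^ 2 * t ^ 2 = (q + θ) ^ 2 := by rw [← hεt]; ring
      calc _ = (ε ^ 2 * t ^ 2) / q ^ 2 * (1 - 2 / q * θ) := by ring
        _ = _ := by rw [this]; field_simp
    rw [e]
    have hz : -1 ≤ θ / q := by rw [le_div_iff₀ hq0]; linarith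
    nlinarith [sq_nonneg (θ / q)]
  have b4 : H / q * ε * (1 - 1 / q * θ) ≤ H / t := by
    rw [le_div_iff₀ ht0]
    have e : H / q * ε * (1 - 1 / q * θ) * t = H * ((1 - θ / q) * (1 + θ / q)) := by
      calc _ = H / q * (ε * t) * (1 - 1 / q * θ) := by ring
        _ = _ := by rw [hεt]; field_simp
    rw [e]
    have : (1 - θ / q) * (1 + θ / q) ≤ 1 := by nlinarith [sq_nonneg (θ / q)]
    nlinarith
  rw [e1]
  have b5 : ε ^ 2 / Q * (1 - 2 / q * θ) + H / q * ε * (1 - 1 / q * θ) ≤ 1 / t ^ 2 * (1 + t * H) := by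
    have : 1 / t ^ 2 * (1 + t * H) = 1 / t ^ 2 + H / t := by field_simp
    linarith
  have c0 : 0 < Real.exp (Q - A - 0.2352) := Real.exp_pos _
  calc _ ≤ 1 / 3 * Real.exp (Q - A - 0.2352) * (1.2352 - θ ^ 2) * (1 / t ^ 2 * (1 + t * H)) :=
        mul_le_mul_of_nonneg_left b5 (by positivity)
    _ = 1 / 3 / t ^ 2 * (Real.exp (Q - A - 0.2352) * (1.2352 - θ ^ 2) * (1 + t * H)) := by ring
    _ ≤ _ := by gcongr

/-- The case of a large deviation and a small tilt. -/
theorem exp_le_mix_of_large {E : ℝ → ℝ} {d A Q ε m : ℝ} (hε : 0 < ε) (hd : 0 < d)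
    (hQ : d * Real.log 2 ≤ Q) (hm : 2 * √Q ≤ m)
    (hJ : ∀ μ, 0 < μ → Real.exp (μ * m - A - μ ^ 2) ≤ E μ)
    (hC : ∀ μ, 0 < μ → Real.exp (d * Real.log (Real.cosh (μ * m / d)) - μ ^ 2) ≤ E μ)
    (hw : 1.26 ≤ √Q) (hεQ : ε ≤ √Q - 0.84)
    (hexp : 3 * √Q ≤ 1.68 * Real.exp (Q - A - 0.2352)) :
    ENNReal.ofReal (Real.exp (ε * (m - 2 * √Q))) ≤ mix E ε := by
  have hQ0 : 0 ≤ Q := le_trans (by positivity) hQ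
  set q := √Q with hq
  have hqq : q ^ 2 = Q := Real.sq_sqrt hQ0
  have hq0 : 0 < q := by linarith
  set c := 1 / 3 * Real.exp (Q - A - 0.2352) with hc
  set H := Real.exp (ε * (m - 2 * q)) - 1 with hH
  have hH0 : 0 ≤ H := by
    rw [hH, sub_nonneg, Real.one_le_exp_iff]
    exact mul_nonneg hε.le (by linarith)
  have hone : ∀ μ, 0 < μ → μ ≤ q → 1 ≤ E μ := fun μ h1 h2 =>
    one_le_of_log_cosh_le hd hQ hC hm h1 h2
  -- The atom and the tilts below the window contribute 1 minus a small tail, using only E ≥ 1. The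
  -- window |εt - q| ≤ 0.84 must supply that tail and the whole of H.
  refine le_mix_of_le_integrals (b := (q - 0.84) / ε) (c := (q + 0.84) / ε) (r₀ := 2 / 3)
    (F := fun t => -(1 / 3) / t) (f := fun t => 1 / 3 / t ^ 2)
    (F' := fun t => c * (ε / Q * (1.2352 * (ε * t - q) - (ε * t - q) ^ 3 / 3
        - 2 / q * (1.2352 * (ε * t - q) ^ 2 / 2 - (ε * t - q) ^ 4 / 4))
      + H / q * (1.2352 * (ε * t - q) - (ε * t - q) ^ 3 / 3
        - 1 / q * (1.2352 * (ε * t - q) ^ 2 / 2 - (ε * t - q) ^ 4 / 4))))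
    (f' := fun t => c * (1.2352 - (ε * t - q) ^ 2) *
      (ε ^ 2 / Q * (1 - 2 / q * (ε * t - q)) + H / q * ε * (1 - 1 / q * (ε * t - q))))
    ?_ ?_ ?_ ?_ ?_ ?_ ?_ ?_ ?_ ?_
  · rw [le_div_iff₀ hε]; linarith
  · gcongr; linarith
  · linarith [hone ε hε (by linarith)]
  · intro t ht
    have ht0 : t ≠ 0 := by linarith [ht.1]
    refine HasDerivAt.congr_deriv
      ((hasDerivAt_const t (-(1 / 3) : ℝ)).div (hasDerivAt_id t) ht0) ?_
    simp
  · apply ContinuousOn.div continuousOn_const (by fun_prop)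
    intro t ht
    have := ht.1
    positivity
  · intro t ht
    have ht1 := ht.1
    have ht0 : 0 < t := by linarith
    have ht2 := ht.2
    rw [le_div_iff₀ hε] at ht2
    have := hone (ε * t) (by positivity) (by linarith)
    exact le_mul_of_one_le_right (by positivity) this
  · intro t _
    have hθ : HasDerivAt (fun t => ε * t - q) ε t := by
      simpa using ((hasDerivAt_id t).const_mul ε).sub_const q
    have h2 := hθ.pow 2
    have h3 := hθ.pow 3
    have h4 := hθ.pow 4
    have := ((((hθ.const_mul 1.2352).sub (h3.div_const 3)).sub
      ((((h2.const_mul 1.2352).div_const 2).sub (h4.div_const 4)).const_mul (2 / q))).const_mul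
        (ε / Q)).add ((((hθ.const_mul 1.2352).sub (h3.div_const 3)).sub
      ((((h2.const_mul 1.2352).div_const 2).sub (h4.div_const 4)).const_mul (1 / q))).const_mul
        (H / q))
    refine HasDerivAt.congr_deriv (this.const_mul c) ?_
    norm_num
    ring
  · fun_prop
  · intro t ht
    have h1 := ht.1
    have h2 := ht.2
    rw [div_le_iff₀ hε] at h1
    rw [le_div_iff₀ hε] at h2
    have ht1 : 1 ≤ t := by
      refine le_trans ?_ ht.1
      rw [le_div_iff₀ hε]; linarith
    refine (window_le hε hQ0 hm hw ht1 (by linarith) (by linarith)).trans ?_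
    exact mul_le_mul_of_nonneg_left (hJ (ε * t) (by positivity)) (by positivity)
  · have e1 : ε * ((q + 0.84) / ε) = q + 0.84 := by field_simp
    have e2 : ε * ((q - 0.84) / ε) = q - 0.84 := by field_simp
    simp only [e1, e2]
    have hq' : 0 < q - 0.84 := by linarith
    have e3 : -(1 / 3) / ((q - 0.84) / ε) - -(1 / 3) / 1 = 1 / 3 - 1 / 3 * (ε / (q - 0.84)) := by
      field_simp; ring
    rw [e3]
    have e4 : Real.exp (ε * (m - 2 * q)) = 1 + H := by rw [hH]; ring
    rw [e4]
    have e5 : ε / Q * q = ε / q := by rw [← hqq]; field_simp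
    have e6 : H / q * q = H := by field_simp
    have key : ε / q + H ≤ c * 1.68 * (ε / Q + H / q) := by
      have : q ≤ c * 1.68 := by rw [hc]; linarith
      calc ε / q + H = q * (ε / Q + H / q) := by rw [mul_add, mul_comm q, mul_comm q, e5, e6]
        _ ≤ _ := mul_le_mul_of_nonneg_right this (by positivity)
    -- Equivalent to q ≤ 3(q - 0.84), that is q ≥ 1.26.
    have key2 : 1 / 3 * (ε / (q - 0.84)) ≤ ε / q := by
      rw [← mul_div_assoc, div_le_div_iff₀ hq' hq0]
      nlinarith
    refine (show 1 + H ≤ 2 / 3 + (1 / 3 - 1 / 3 * (ε / (q - 0.84))) + c * 1.68 * (ε / Q + H / q) by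
      linarith).trans (le_of_eq ?_)
    ring

/-! ### Numerical bounds -/

theorem taylor_le_cosh (x : ℝ) :
    1 + x ^ 2 / 2 + x ^ 4 / 24 + x ^ 6 / 720 + x ^ 8 / 40320 ≤ Real.cosh x := by
  have h := sum_le_hasSum (Finset.range 5) (fun i _ => by
    have : 0 ≤ x ^ (2 * i) := by rw [pow_mul]; positivity
    positivity) (Real.hasSum_cosh x)
  refine le_trans (le_of_eq ?_) h
  norm_num [Finset.sum_range_succ, Nat.factorial]

theorem exp_le_taylor {s : ℝ} (h0 : 0 ≤ s) (h1 : s ≤ 1) :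
    Real.exp s ≤ 1 + s + s ^ 2 / 2 + s ^ 3 / 6 + s ^ 4 / 24 + s ^ 5 / 100 := by
  have h := Real.exp_bound' h0 h1 (n := 5) (by norm_num)
  refine h.trans (le_of_eq ?_)
  norm_num [Finset.sum_range_succ, Nat.factorial]
  ring

theorem pow_le_mul_pow {t c : ℝ} (ht : 0 ≤ t) (htc : t ≤ c) (n : ℕ) : t ^ (n + 1) ≤ c ^ n * t := by
  rw [pow_succ]
  gcongr

/-- 0.3607 is 1/(4 log 2) rounded up, the price in `three_mul_log_cosh_le` of each unit of exponent
beyond 3. After exponentiation, Taylor polynomials in t = x² are compared, with powers of t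
linearised through t ≤ 1.16². -/
theorem mul_sq_le_log_cosh {x : ℝ} (h0 : 0 ≤ x) (h1 : x ≤ 1.16) :
    0.3607 * x ^ 2 ≤ Real.log (Real.cosh x) := by
  rw [Real.le_log_iff_exp_le (Real.cosh_pos x)]
  have ht : x ^ 2 ≤ 1.3456 := by nlinarith
  refine (exp_le_taylor (by positivity) (by linarith)).trans
    (le_trans ?_ (taylor_le_cosh x))
  have e4 : x ^ 4 = (x ^ 2) ^ 2 := by ring
  have e6 : x ^ 6 = (x ^ 2) ^ 3 := by ring
  have e8 : x ^ 8 = (x ^ 2) ^ 4 := by ring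
  rw [e4, e6, e8]
  set t := x ^ 2 with htdef
  have ht0 : 0 ≤ t := by positivity
  have p2 := pow_le_mul_pow ht0 ht 1
  have p3 := pow_le_mul_pow ht0 ht 2
  have p4 := pow_le_mul_pow ht0 ht 3
  have p5 := pow_le_mul_pow ht0 ht 4
  have q3 : 0 ≤ t ^ 3 := by positivity
  have q4 : 0 ≤ t ^ 4 := by positivity
  norm_num at p2 p3 p4 p5 ⊢
  ring_nf at p2 p3 p4 p5 ⊢
  linarith

/-- 7.388 = 4 · 1.847, where 1.847 bounds Q from below. This feeds the hypothesis `hg` of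
`exp_le_mix_of_small` for d = 1 and X = 1.89. -/
theorem one_add_mul_exp_le_cosh {x : ℝ} (h0 : 0 ≤ x) (h1 : x ≤ 1.89) :
    (1 + x ^ 2 / 1.89 ^ 2) * Real.exp (x ^ 2 / 7.388) ≤ Real.cosh x := by
  have ht : x ^ 2 ≤ 3.5721 := by nlinarith
  refine (mul_le_mul_of_nonneg_left (exp_le_taylor (by positivity) (by
    rw [div_le_one] <;> linarith)) (by positivity)).trans (le_trans ?_ (taylor_le_cosh x))
  have e4 : x ^ 4 = (x ^ 2) ^ 2 := by ring
  have e6 : x ^ 6 = (x ^ 2) ^ 3 := by ring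
  have e8 : x ^ 8 = (x ^ 2) ^ 4 := by ring
  rw [e4, e6, e8]
  set t := x ^ 2 with htdef
  have ht0 : 0 ≤ t := by positivity
  have p2 := pow_le_mul_pow ht0 ht 1
  have p3 := pow_le_mul_pow ht0 ht 2
  have p4 := pow_le_mul_pow ht0 ht 3
  have p5 := pow_le_mul_pow ht0 ht 4
  have p6 := pow_le_mul_pow ht0 ht 5
  norm_num at p2 p3 p4 p5 p6 ⊢
  ring_nf at p2 p3 p4 p5 p6 ⊢
  linarith

/-- The counterpart for exponent 3 and X = 1.16: 0.702 exceeds 9/(4Q) as soon as Q ≥ 3 log 2 + 1.13.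
-/
theorem one_add_mul_exp_le_cosh_pow {x : ℝ} (h0 : 0 ≤ x) (h1 : x ≤ 1.16) :
    (1 + x ^ 2 / 1.16 ^ 2) * Real.exp (0.702 * x ^ 2) ≤ Real.cosh x ^ 3 := by
  have ht : x ^ 2 ≤ 1.3456 := by nlinarith
  have hc : 1 + x ^ 2 / 2 + (x ^ 2) ^ 2 / 24 ≤ Real.cosh x := by
    have := taylor_le_cosh x
    have h6 : 0 ≤ x ^ 6 := by positivity
    have h8 : 0 ≤ x ^ 8 := by positivity
    have e4 : x ^ 4 = (x ^ 2) ^ 2 := by ring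
    rw [e4] at this
    linarith
  refine (mul_le_mul_of_nonneg_left (exp_le_taylor (by positivity) (by linarith))
    (by positivity)).trans (le_trans ?_ (pow_le_pow_left₀ (by positivity) hc 3))
  set t := x ^ 2 with htdef
  have ht0 : 0 ≤ t := by positivity
  have p4 := pow_le_mul_pow ht0 ht 3
  have p5 := pow_le_mul_pow ht0 ht 4
  have p6 := pow_le_mul_pow ht0 ht 5
  have q2 : 0 ≤ t ^ 2 := by positivity
  have p4' : t ^ 4 ≤ 1.3456 ^ 2 * t ^ 2 := by nlinarith
  have p5' : t ^ 5 ≤ 1.3456 ^ 3 * t ^ 2 := by nlinarith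
  have p6' : t ^ 6 ≤ 1.3456 ^ 4 * t ^ 2 := by nlinarith
  have q3 : 0 ≤ t ^ 3 := by positivity
  norm_num at p4' p5' p6' ⊢
  ring_nf at p4' p5' p6' ⊢
  linarith

/-! ### Small deviations: slopes of log cosh -/

theorem monotone_tanh : Monotone Real.tanh :=
  monotone_of_deriv_nonneg (fun x => (hasDerivAt_tanh x).differentiableAt) fun x => by
    rw [(hasDerivAt_tanh x).deriv]; positivity

theorem tanh_le_self {x : ℝ} (hx : 0 ≤ x) : Real.tanh x ≤ x := by
  have h : MonotoneOn (fun x => x - Real.tanh x) (Set.Ici 0) := by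
    apply Monotone.monotoneOn
    apply monotone_of_deriv_nonneg (fun x =>
      ((hasDerivAt_id x).sub (hasDerivAt_tanh x)).differentiableAt)
    intro x
    rw [((hasDerivAt_id x).sub (hasDerivAt_tanh x)).deriv, sub_nonneg, div_le_one
      (pow_pos (Real.cosh_pos x) 2)]
    nlinarith [Real.one_le_cosh x]
  have := h (Set.mem_Ici.2 le_rfl) (Set.mem_Ici.2 hx) hx
  simp at this
  linarith

theorem tanh_le_of_exp_le {a T : ℝ}
    (h : Real.exp (2 * a) * (1 - T) ≤ 1 + T) : Real.tanh a ≤ T := by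
  rw [Real.tanh_eq_sinh_div_cosh, div_le_iff₀ (Real.cosh_pos a), Real.sinh_eq, Real.cosh_eq]
  have e : Real.exp (2 * a) = Real.exp a * Real.exp a := by rw [← Real.exp_add]; ring_nf
  have e' : Real.exp a * Real.exp (-a) = 1 := by rw [← Real.exp_add]; simp
  have hp := Real.exp_pos (-a)
  have := mul_le_mul_of_nonneg_right h hp.le
  have e2 : Real.exp (2 * a) * (1 - T) * Real.exp (-a) = Real.exp a * (1 - T) := by
    rw [e]
    calc _ = Real.exp a * (1 - T) * (Real.exp a * Real.exp (-a)) := by ring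
      _ = _ := by rw [e', mul_one]
  rw [e2] at this
  linarith

/-- The tangent of the convex function `log cosh` at `x`. -/
theorem log_cosh_sub_le {x y : ℝ} (hyx : y ≤ x) :
    Real.log (Real.cosh x) - Real.tanh x * (x - y) ≤ Real.log (Real.cosh y) := by
  have hd : ∀ z, HasDerivAt (fun z => Real.log (Real.cosh z) - Real.tanh x * z)
      (Real.tanh z - Real.tanh x * 1) z := fun z => by
    refine HasDerivAt.congr_deriv (((Real.hasDerivAt_cosh z).log (Real.cosh_pos z).ne').sub
      ((hasDerivAt_id z).const_mul (Real.tanh x))) ?_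
    rw [Real.tanh_eq_sinh_div_cosh z]
  have h : AntitoneOn (fun z => Real.log (Real.cosh z) - Real.tanh x * z) (Set.Iic x) := by
    apply antitoneOn_of_deriv_nonpos (convex_Iic x)
    · exact fun z _ => (hd z).continuousAt.continuousWithinAt
    · exact fun z _ => (hd z).differentiableAt.differentiableWithinAt
    · rw [interior_Iic]
      intro z hz
      rw [(hd z).deriv]
      have := monotone_tanh (le_of_lt hz)
      linarith
  have := h (Set.mem_Iic.2 hyx) (Set.mem_Iic.2 le_rfl) hyx
  simp only at this
  linarith

/-- The case of a small deviation and a tilt of medium size. -/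
theorem exp_le_mix_of_mid {E : ℝ → ℝ} {d Q ε m : ℝ} (hε : 0 < ε) (hd : 0 < d)
    (hm : m ≤ 2 * √Q)
    (hC : ∀ μ, 0 < μ → Real.exp (d * Real.log (Real.cosh (μ * m / d)) - μ ^ 2) ≤ E μ)
    (h : 0.4055 ≤ d * Real.log (Real.cosh (2 * √Q / d * ε)) - ε ^ 2) :
    ENNReal.ofReal (Real.exp (ε * (m - 2 * √Q))) ≤ mix E ε := by
  refine le_mix_of_le (exp_le_two_thirds_mul ?_ (hC ε hε))
  have hxy : ε * m / d ≤ 2 * √Q / d * ε := by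
    rw [div_mul_eq_mul_div]
    refine div_le_div_of_nonneg_right ?_ hd.le
    nlinarith
  have h1 := log_cosh_sub_le hxy
  -- The slope of log cosh is below 1, so lowering m from 2√Q costs no more than the target itself
  -- loses. Only m = 2√Q has to be checked.
  have h2 : Real.tanh (2 * √Q / d * ε) * (2 * √Q / d * ε - ε * m / d) ≤
      1 * (2 * √Q / d * ε - ε * m / d) :=
    mul_le_mul_of_nonneg_right (Real.tanh_lt_one _).le (by linarith)
  have h3 := mul_le_mul_of_nonneg_left (add_le_add h1 h2) hd.le
  have h4 : d * (1 * (2 * √Q / d * ε - ε * m / d)) = 2 * √Q * ε - ε * m := by field_simp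
  nlinarith

/-- Lower bound for a small tilt. -/
theorem tilt_le {E : ℝ → ℝ} {d Q ε m t τ x g : ℝ} (hε : 0 < ε) (hd : 0 < d) (ht : 0 < t)
    (hQ : 0 < Q) (hm : m ≤ 2 * √Q)
    (hC : ∀ μ, 0 < μ → Real.exp (d * Real.log (Real.cosh (μ * m / d)) - μ ^ 2) ≤ E μ)
    (hx : x = 2 * √Q / d * ε * t) (hτ : Real.tanh x ≤ τ) (hg0 : 0 ≤ g)
    (hg : g ≤ Real.exp (d * Real.log (Real.cosh x) - d ^ 2 / (4 * Q) * x ^ 2)) :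
    g * (Real.exp (ε * (m - 2 * √Q)) * (1 + (τ * t - 1) * (ε * (m - 2 * √Q)))) ≤ E (ε * t) := by
  set Y := ε * (m - 2 * √Q) with hY
  have hY0 : Y ≤ 0 := mul_nonpos_of_nonneg_of_nonpos hε.le (by linarith)
  have hq : 0 < √Q := Real.sqrt_pos.2 hQ
  -- With the target e^Y factored out, linearising in Y makes the bound affine, so that after
  -- integration over t only the sign of the coefficient of Y matters.
  have h0 : Real.exp Y * (1 + (τ * t - 1) * Y) ≤ Real.exp (τ * t * Y) := by
    have := Real.add_one_le_exp ((τ * t - 1) * Y)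
    calc _ ≤ Real.exp Y * Real.exp ((τ * t - 1) * Y) := by
          gcongr; linarith
      _ = _ := by rw [← Real.exp_add]; ring_nf
  refine (mul_le_mul_of_nonneg_left h0 hg0).trans ?_
  refine (mul_le_mul_of_nonneg_right hg (Real.exp_pos _).le).trans ?_
  rw [← Real.exp_add]
  refine le_trans (Real.exp_le_exp.2 ?_) (hC (ε * t) (by positivity))
  have hxy : ε * t * m / d ≤ x := by
    rw [hx, div_mul_eq_mul_div, div_mul_eq_mul_div]
    refine div_le_div_of_nonneg_right ?_ hd.le
    nlinarith [mul_pos hε ht]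
  have h1 := log_cosh_sub_le hxy
  have h2 := mul_le_mul_of_nonneg_right hτ (sub_nonneg.2 hxy)
  have h3 := mul_le_mul_of_nonneg_left (add_le_add h1 h2) hd.le
  have h4 : d * (τ * (x - ε * t * m / d)) = -(τ * t * Y) := by
    rw [hx, hY]; field_simp; ring
  have h5 : d ^ 2 / (4 * Q) * x ^ 2 = (ε * t) ^ 2 := by
    have := Real.sq_sqrt hQ.le
    rw [hx]
    field_simp
    rw [this]
    ring
  rw [h5]
  nlinarith

/-- The antiderivatives which appear in the lower bounds for small tilts. -/
theorem hasDerivAt_aux {e Y x κ α β γ t : ℝ} (ht : t ≠ 0) :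
    HasDerivAt (fun t => 1 / 3 * e * ((1 - Y) * (-1 / t + κ * x ^ 2 * t)
        + Y * (α * t + β * t ^ 2 / 2 + γ * t ^ 3 / 3)))
      (1 / 3 * e * ((1 - Y) * (1 / t ^ 2 + κ * x ^ 2) + Y * (α + β * t + γ * t ^ 2))) t := by
  have h1 : HasDerivAt (fun t : ℝ => -1 / t) (1 / t ^ 2) t := by
    refine HasDerivAt.congr_deriv ((hasDerivAt_const t (-1 : ℝ)).div (hasDerivAt_id t) ht) ?_
    simp
  have h0 := hasDerivAt_id t
  have h2 := (hasDerivAt_id t).pow 2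
  have h3 := (hasDerivAt_id t).pow 3
  refine HasDerivAt.congr_deriv ((((h1.add (h0.const_mul (κ * x ^ 2))).const_mul (1 - Y)).add
    ((((h0.const_mul α).add ((h2.const_mul β).div_const 2)).add
      ((h3.const_mul γ).div_const 3)).const_mul Y)).const_mul (1 / 3 * e)) ?_
  simp only [id_eq, Nat.cast_ofNat]
  ring

theorem continuousOn_aux {e Y x κ α β γ b c : ℝ} (hb : 0 < b) :
    ContinuousOn (fun t : ℝ => 1 / 3 * e * ((1 - Y) * (1 / t ^ 2 + κ * x ^ 2)
      + Y * (α + β * t + γ * t ^ 2))) (Set.Icc b c) := by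
  have : ContinuousOn (fun t : ℝ => 1 / t ^ 2) (Set.Icc b c) :=
    ContinuousOn.div continuousOn_const (by fun_prop) fun t ht => by
      have : 0 < t := hb.trans_le ht.1
      positivity
  fun_prop

/-- Common form of the integrand on both intervals: `r` stands for a polynomial in t, integrable in
closed form, that minorises the term carrying the slope τ. -/
theorem mix_cases_aux {s t g e τ κ x Y r : ℝ} (ht : 0 < t) (h : (1 + κ * (x * t) ^ 2) *
      (e * (1 + (τ * t - 1) * Y)) ≤ s) (hr : r ≤ Y * (1 + κ * (x * t) ^ 2) * (τ / t))
    (he : 0 ≤ e) (hg : g = 1 / 3 * e * ((1 - Y) * (1 / t ^ 2 + κ * x ^ 2) + r)) :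
    g ≤ 1 / 3 / t ^ 2 * s := by
  refine le_trans ?_ (mul_le_mul_of_nonneg_left h (by positivity))
  rw [hg]
  have e1 : 1 / 3 / t ^ 2 * ((1 + κ * (x * t) ^ 2) * (e * (1 + (τ * t - 1) * Y))) =
      1 / 3 * e * ((1 - Y) * (1 / t ^ 2 + κ * x ^ 2) + Y * (1 + κ * (x * t) ^ 2) * (τ / t)) := by
    field_simp
    ring
  rw [e1]
  gcongr

/-- The case of a small deviation and a small tilt, where the slopes are bounded by `tanh x ≤ x`
up to `1` and by `1` from there on. -/
theorem exp_le_mix_of_small {E : ℝ → ℝ} {d Q ε m X Z x₀ τ₀ : ℝ} (hε : 0 < ε) (hd : 0 < d)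
    (hQ : 0 < Q) (hm : m ≤ 2 * √Q)
    (hC : ∀ μ, 0 < μ → Real.exp (d * Real.log (Real.cosh (μ * m / d)) - μ ^ 2) ≤ E μ)
    (hx₀ : x₀ = 2 * √Q / d * ε) (hτ₀ : Real.tanh x₀ ≤ τ₀) (hZ : x₀ ≤ Z) (hZX : Z ≤ X)
    (hZ1 : 1 ≤ Z)
    (hg : ∀ x, 0 ≤ x → x ≤ X → 1 + 1 / X ^ 2 * x ^ 2 ≤
      Real.exp (d * Real.log (Real.cosh x) - d ^ 2 / (4 * Q) * x ^ 2))
    (h : 2 / 3 * (1 + 1 / X ^ 2 * x₀ ^ 2) * τ₀ + 1 / 3 * ((Z - x₀) + 1 / X ^ 2 * (Z ^ 3 - x₀ ^ 3) / 3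
      + (1 + 1 / X) * (X - Z) - (1 / X - 1 / X ^ 2) * (X ^ 2 - Z ^ 2) / 2) ≤
        1 + 1 / X ^ 2 * x₀ ^ 2 / 3) :
    ENNReal.ofReal (Real.exp (ε * (m - 2 * √Q))) ≤ mix E ε := by
  have hq : 0 < √Q := Real.sqrt_pos.2 hQ
  have hx0 : 0 < x₀ := by rw [hx₀]; positivity
  have hX0 : 0 < X := by linarith
  -- With this κ, the gain κx² over the interval cancels the Pareto mass x₀/X discarded beyond t =
  -- X/x₀. At Y = 0 the total is exactly 1 + κx₀²/3.
  set κ := 1 / X ^ 2 with hκ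
  have hκ0 : 0 < κ := by positivity
  set Y := ε * (m - 2 * √Q) with hY
  have hY0 : Y ≤ 0 := mul_nonpos_of_nonneg_of_nonpos hε.le (by linarith)
  set e := Real.exp Y with he
  have he0 : 0 < e := Real.exp_pos _
  have tilt : ∀ t τ, 0 < t → x₀ * t ≤ X → Real.tanh (x₀ * t) ≤ τ →
      (1 + κ * (x₀ * t) ^ 2) * (e * (1 + (τ * t - 1) * Y)) ≤ E (ε * t) := by
    intro t τ ht hX hτ
    exact tilt_le hε hd ht hQ hm hC (by rw [hx₀]) hτ (by positivity) (hg _ (by positivity) hX)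
  refine le_mix_of_le_integrals (b := Z / x₀) (c := X / x₀)
    (r₀ := 2 / 3 * ((1 + κ * x₀ ^ 2) * (e * (1 + (τ₀ - 1) * Y))))
    (F := fun t => 1 / 3 * e * ((1 - Y) * (-1 / t + κ * x₀ ^ 2 * t)
        + Y * (x₀ * t + 0 * t ^ 2 / 2 + (κ * x₀ ^ 3) * t ^ 3 / 3)))
    (f := fun t => 1 / 3 * e * ((1 - Y) * (1 / t ^ 2 + κ * x₀ ^ 2)
        + Y * (x₀ + 0 * t + (κ * x₀ ^ 3) * t ^ 2)))
    (F' := fun t => 1 / 3 * e * ((1 - Y) * (-1 / t + κ * x₀ ^ 2 * t)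
        + Y * (x₀ * (1 + 1 / X) * t + (κ * x₀ ^ 2 - x₀ ^ 2 / X) * t ^ 2 / 2 + 0 * t ^ 3 / 3)))
    (f' := fun t => 1 / 3 * e * ((1 - Y) * (1 / t ^ 2 + κ * x₀ ^ 2)
        + Y * (x₀ * (1 + 1 / X) + (κ * x₀ ^ 2 - x₀ ^ 2 / X) * t + 0 * t ^ 2)))
    ?_ ?_ ?_ ?_ ?_ ?_ ?_ ?_ ?_ ?_
  · rwa [le_div_iff₀ hx0, one_mul]
  · gcongr
  · have := tilt 1 τ₀ one_pos (by linarith) (by rwa [mul_one])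
    simp only [mul_one] at this
    linarith
  · exact fun t ht => hasDerivAt_aux (by linarith [ht.1])
  · exact continuousOn_aux one_pos
  · intro t ht
    have ht0 : 0 < t := by linarith [ht.1]
    have h2 := ht.2
    rw [le_div_iff₀ hx0] at h2
    refine mix_cases_aux ht0 (tilt t (x₀ * t) ht0 (by linarith)
      (tanh_le_self (by positivity))) (le_of_eq ?_) he0.le rfl
    field_simp
    ring
  · intro t ht
    have : 0 < Z / x₀ := div_pos (by linarith) hx0
    exact hasDerivAt_aux (by linarith [ht.1])
  · exact continuousOn_aux (div_pos (by linarith) hx0)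
  · intro t ht
    have h1 := ht.1
    have h2 := ht.2
    have ht0 : 0 < t := lt_of_lt_of_le (div_pos (by linarith) hx0) h1
    rw [le_div_iff₀ hx0] at h2
    rw [div_le_iff₀ hx0] at h1
    refine mix_cases_aux ht0 (tilt t 1 ht0 (by linarith) (Real.tanh_lt_one _).le) ?_ he0.le rfl
    rw [mul_assoc Y]
    refine mul_le_mul_of_nonpos_left ?_ hY0
    -- The convex function 1/t lies below its chord between x₀t = 1 and x₀t = X; this avoids a
    -- logarithm in the antiderivative.
    have h3 : 1 / t ≤ x₀ * (1 + 1 / X) - x₀ ^ 2 / X * t := by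
      rw [div_le_iff₀ ht0]
      have e1 : (x₀ * (1 + 1 / X) - x₀ ^ 2 / X * t) * t = 1 + (x₀ * t - 1) * (X - x₀ * t) / X := by
        field_simp
        ring
      rw [e1]
      have : 0 ≤ (x₀ * t - 1) * (X - x₀ * t) / X :=
        div_nonneg (mul_nonneg (by linarith) (by linarith)) hX0.le
      linarith
    have e2 : (1 + κ * (x₀ * t) ^ 2) * (1 / t) = 1 / t + κ * x₀ ^ 2 * t := by field_simp
    rw [e2]
    linarith
  · have hZ0 : 0 < Z := by linarith
    have e0 : (2 / 3 * ((1 + κ * x₀ ^ 2) * (e * (1 + (τ₀ - 1) * Y)))) +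
        (1 / 3 * e * ((1 - Y) * (-1 / (Z / x₀) + κ * x₀ ^ 2 * (Z / x₀))
          + Y * (x₀ * (Z / x₀) + 0 * (Z / x₀) ^ 2 / 2 + (κ * x₀ ^ 3) * (Z / x₀) ^ 3 / 3)) -
        1 / 3 * e * ((1 - Y) * (-1 / 1 + κ * x₀ ^ 2 * 1)
          + Y * (x₀ * 1 + 0 * 1 ^ 2 / 2 + (κ * x₀ ^ 3) * 1 ^ 3 / 3))) +
        (1 / 3 * e * ((1 - Y) * (-1 / (X / x₀) + κ * x₀ ^ 2 * (X / x₀))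
          + Y * (x₀ * (1 + 1 / X) * (X / x₀) + (κ * x₀ ^ 2 - x₀ ^ 2 / X) * (X / x₀) ^ 2 / 2
            + 0 * (X / x₀) ^ 3 / 3)) -
        1 / 3 * e * ((1 - Y) * (-1 / (Z / x₀) + κ * x₀ ^ 2 * (Z / x₀))
          + Y * (x₀ * (1 + 1 / X) * (Z / x₀) + (κ * x₀ ^ 2 - x₀ ^ 2 / X) * (Z / x₀) ^ 2 / 2
            + 0 * (Z / x₀) ^ 3 / 3))) =
        e * (1 + κ * x₀ ^ 2 / 3 + Y * (2 / 3 * (1 + κ * x₀ ^ 2) * τ₀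
          + 1 / 3 * ((Z - x₀) + κ * (Z ^ 3 - x₀ ^ 3) / 3 + (1 + 1 / X) * (X - Z)
            - (1 / X - κ) * (X ^ 2 - Z ^ 2) / 2) - (1 + κ * x₀ ^ 2 / 3))) := by
      rw [hκ]
      field_simp
      ring
    -- Since Y ≤ 0, it remains to see that the coefficient of Y is nonpositive, which is `h`.
    refine le_trans ?_ (le_of_eq e0.symm)
    refine le_mul_of_one_le_right he0.le ?_
    have h5 := mul_nonneg_of_nonpos_of_nonpos hY0 (sub_nonpos.2 h)
    have h6 : 0 ≤ κ * x₀ ^ 2 / 3 := by positivity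
    linarith

theorem tanh_bounds :
    Real.tanh 0.8 ≤ 0.665 ∧ Real.tanh 1 ≤ 0.762 ∧ Real.tanh 1.23 ≤ 0.843 := by
  refine ⟨tanh_le_of_exp_le ?_, tanh_le_of_exp_le ?_, tanh_le_of_exp_le ?_⟩
  · have h := exp_le_taylor (s := 0.8) (by norm_num) (by norm_num)
    have e : Real.exp (2 * 0.8) = Real.exp 0.8 ^ 2 := by rw [← Real.exp_nat_mul]; norm_num
    rw [e]
    have := pow_le_pow_left₀ (Real.exp_pos _).le h 2
    norm_num at this ⊢
    linarith
  · have h := exp_le_taylor (s := 1) (by norm_num) (by norm_num)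
    have e : Real.exp (2 * 1) = Real.exp 1 ^ 2 := by rw [← Real.exp_nat_mul]; norm_num
    rw [e]
    have := pow_le_pow_left₀ (Real.exp_pos _).le h 2
    norm_num at this ⊢
    linarith
  · have h := exp_le_taylor (s := 0.82) (by norm_num) (by norm_num)
    have e : Real.exp (2 * 1.23) = Real.exp 0.82 ^ 3 := by rw [← Real.exp_nat_mul]; norm_num
    rw [e]
    have := pow_le_pow_left₀ (Real.exp_pos _).le h 3
    norm_num at this ⊢
    linarith

/-- A comparison valid for at least three states. -/
theorem three_mul_log_cosh_le {d Q x : ℝ} (hd : 3 ≤ d) (hQ : d * Real.log 2 + 1.13 ≤ Q)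
    (h0 : 0 ≤ x) (h1 : x ≤ 1.16) :
    3 * Real.log (Real.cosh x) - 0.702 * x ^ 2 ≤
      d * Real.log (Real.cosh x) - d ^ 2 / (4 * Q) * x ^ 2 := by
  have h := mul_sq_le_log_cosh h0 h1
  have hl := Real.log_two_gt_d9
  have hQ' : 0.6931471 * d + 1.13 ≤ Q := by nlinarith
  have hQ0 : 0 < Q := by linarith
  -- The Gaussian coefficient grows with d at a rate of at most 1/(4 log 2) < 0.3607, and each extra
  -- unit of exponent brings log cosh x ≥ 0.3607 x². So d = 3 is the worst case.
  have h2 : d ^ 2 / (4 * Q) ≤ 0.702 + 0.3607 * (d - 3) := by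
    rw [div_le_iff₀ (by linarith)]
    nlinarith [mul_le_mul_of_nonneg_left hQ' (show 0 ≤ 0.702 + 0.3607 * (d - 3) by linarith)]
  nlinarith [mul_le_mul_of_nonneg_right h2 (sq_nonneg x),
    mul_le_mul_of_nonneg_left h (sub_nonneg.2 hd)]

/-- Concavity in the squared tilt reduces this to two tilts: the one with cosh argument ξ, and √Q -
0.84, where log cosh x ≥ x - log 2 leaves Q - d log 2 - 0.84² ≥ 1.13 - 0.7056 > 0.4055. -/
theorem le_log_cosh_of_le {d Q x₀ ε ξ : ℝ} (hd : 0 < d) (hQ : d * Real.log 2 + 1.13 ≤ Q)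
    (hx₀ : x₀ = 2 * √Q / d * ε) (hξ0 : 0 ≤ ξ) (hξ : ξ ≤ x₀) (hε : ε ≤ √Q - 0.84)
    (h : 0.4055 ≤ d * Real.log (Real.cosh ξ) - d ^ 2 / (4 * Q) * ξ ^ 2) :
    0.4055 ≤ d * Real.log (Real.cosh (2 * √Q / d * ε)) - ε ^ 2 := by
  have hl := Real.log_pos (one_lt_two (α := ℝ))
  have hQ0 : 0 < Q := by nlinarith
  have hq : 0 < √Q := Real.sqrt_pos.2 hQ0
  have hqq : √Q ^ 2 = Q := Real.sq_sqrt hQ0.le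
  refine le_log_cosh_sub_sq (a := ξ * d / (2 * √Q)) (b := √Q - 0.84) hd.le (by positivity)
    (by positivity) ?_ ?_ ?_ hε
  · have e1 : 2 * √Q / d * (ξ * d / (2 * √Q)) = ξ := by field_simp
    have e2 : (ξ * d / (2 * √Q)) ^ 2 = d ^ 2 / (4 * Q) * ξ ^ 2 := by
      rw [div_pow, mul_pow, mul_pow, hqq]; ring
    rwa [e1, e2]
  · have h1 := mul_le_mul_of_nonneg_left (sub_log_two_le_log_cosh (2 * √Q / d * (√Q - 0.84))) hd.le
    have e : d * (2 * √Q / d * (√Q - 0.84) - Real.log 2) =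
        2 * √Q * (√Q - 0.84) - d * Real.log 2 := by field_simp
    nlinarith
  · rw [div_le_iff₀ (by positivity)]
    rw [hx₀] at hξ
    calc ξ * d ≤ 2 * √Q / d * ε * d := mul_le_mul_of_nonneg_right hξ hd.le
      _ = _ := by field_simp

/-- The cosh argument x at the threshold deviation decides: up to 0.8 the Pareto part is used,
beyond it the atom suffices. -/
theorem exp_le_mix_of_small_of_three_le {E : ℝ → ℝ} {d Q ε m : ℝ} (hε : 0 < ε) (hd : 3 ≤ d)
    (hQ : d * Real.log 2 + 1.13 ≤ Q) (hm : m ≤ 2 * √Q)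
    (hC : ∀ μ, 0 < μ → Real.exp (d * Real.log (Real.cosh (μ * m / d)) - μ ^ 2) ≤ E μ)
    (hεQ : ε ≤ √Q - 0.84) :
    ENNReal.ofReal (Real.exp (ε * (m - 2 * √Q))) ≤ mix E ε := by
  have hd0 : 0 < d := by linarith
  have hQ0 : 0 < Q := by nlinarith [Real.log_pos (one_lt_two (α := ℝ))]
  have hq : 0 < √Q := Real.sqrt_pos.2 hQ0
  obtain ⟨x, hx⟩ : ∃ x, x = 2 * √Q / d * ε := ⟨_, rfl⟩
  have hx0 : 0 < x := by rw [hx]; positivity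
  rcases le_total x 0.8 with h | h
  · refine exp_le_mix_of_small (X := 1.16) (Z := 1) hε hd0 hQ0 hm hC hx (tanh_le_self hx0.le)
      (by linarith) (by norm_num) le_rfl (fun z hz hz' => ?_) ?_
    · refine le_trans ?_ (Real.exp_le_exp.2 (three_mul_log_cosh_le hd hQ hz hz'))
      have h1 := one_add_mul_exp_le_cosh_pow hz hz'
      rw [Real.exp_sub, le_div_iff₀ (Real.exp_pos _)]
      have e : Real.exp (3 * Real.log (Real.cosh z)) = Real.cosh z ^ 3 := by
        rw [show (3 : ℝ) = ((3 : ℕ) : ℝ) by norm_num, Real.exp_nat_mul,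
          Real.exp_log (Real.cosh_pos z)]
      rw [e]
      calc _ = (1 + z ^ 2 / 1.16 ^ 2) * Real.exp (0.702 * z ^ 2) := by ring
        _ ≤ _ := h1
    · have h3 : x ^ 3 ≤ 0.8 ^ 2 * x := pow_le_mul_pow hx0.le h 2
      norm_num at h3 ⊢
      nlinarith
  · refine exp_le_mix_of_mid hε hd0 hm hC (le_log_cosh_of_le hd0 hQ hx (by norm_num) h hεQ ?_)
    refine le_trans ?_ (three_mul_log_cosh_le hd hQ (x := 0.8) (by norm_num) (by norm_num))
    have h1 := taylor_le_cosh 0.8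
    have h2 : (0.2850) ≤ Real.log (Real.cosh 0.8) := by
      rw [Real.le_log_iff_exp_le (Real.cosh_pos _)]
      refine (exp_le_taylor (by norm_num) (by norm_num)).trans (le_trans ?_ h1)
      norm_num
    norm_num at h2 ⊢
    linarith

/-- For d = 1 the atom suffices only from x = 1.23 on. The Pareto range is cut at 0.6, 0.8 and 1 to
sharpen the bound on tanh x, which is x itself on the first piece and the value at the right end on
the others. -/
theorem exp_le_mix_of_small_of_two {E : ℝ → ℝ} {Q ε m : ℝ} (hε : 0 < ε)
    (hQ : 1.847 ≤ Q) (hm : m ≤ 2 * √Q)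
    (hC : ∀ μ, 0 < μ → Real.exp ((1 : ℝ) * Real.log (Real.cosh (μ * m / 1)) - μ ^ 2) ≤ E μ)
    (hεQ : ε ≤ √Q - 0.84) :
    ENNReal.ofReal (Real.exp (ε * (m - 2 * √Q))) ≤ mix E ε := by
  have hQ0 : 0 < Q := by linarith
  have hq : 0 < √Q := Real.sqrt_pos.2 hQ0
  obtain ⟨x, hx⟩ : ∃ x, x = 2 * √Q / 1 * ε := ⟨_, rfl⟩
  have hx0 : 0 < x := by rw [hx]; positivity
  have hinv : ∀ z : ℝ, (1 : ℝ) ^ 2 / (4 * Q) * z ^ 2 ≤ z ^ 2 / 7.388 := by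
    intro z
    rw [div_mul_eq_mul_div, one_pow, one_mul]
    gcongr
    linarith
  have hg : ∀ z, 0 ≤ z → z ≤ 1.89 → 1 + 1 / 1.89 ^ 2 * z ^ 2 ≤
      Real.exp (1 * Real.log (Real.cosh z) - 1 ^ 2 / (4 * Q) * z ^ 2) := by
    intro z hz hz'
    refine le_trans ?_ (Real.exp_le_exp.2 (sub_le_sub_left (hinv z) _))
    rw [Real.exp_sub, le_div_iff₀ (Real.exp_pos _), one_mul, Real.exp_log (Real.cosh_pos z)]
    calc _ = (1 + z ^ 2 / 1.89 ^ 2) * Real.exp (z ^ 2 / 7.388) := by ring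
      _ ≤ _ := one_add_mul_exp_le_cosh hz hz'
  obtain ⟨t1, t2, t3⟩ := tanh_bounds
  rcases le_total x 0.6 with h | h
  · refine exp_le_mix_of_small (X := 1.89) (Z := 1) hε one_pos hQ0 hm hC hx (tanh_le_self hx0.le)
      (by linarith) (by norm_num) le_rfl hg ?_
    have h3 : x ^ 3 ≤ 0.6 ^ 2 * x := pow_le_mul_pow hx0.le h 2
    norm_num at h3 ⊢
    nlinarith
  rcases le_total x 0.8 with h' | h'
  · refine exp_le_mix_of_small (X := 1.89) (Z := 1) hε one_pos hQ0 hm hC hx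
      ((monotone_tanh h').trans t1) (by linarith) (by norm_num) le_rfl hg ?_
    have h3 : 0.6 ^ 3 ≤ x ^ 3 := by gcongr
    norm_num at h3 ⊢
    nlinarith
  rcases le_total x 1 with h'' | h''
  · refine exp_le_mix_of_small (X := 1.89) (Z := 1) hε one_pos hQ0 hm hC hx
      ((monotone_tanh h'').trans t2) (by linarith) (by norm_num) le_rfl hg ?_
    have h3 : 0.8 ^ 3 ≤ x ^ 3 := by gcongr
    norm_num at h3 ⊢
    nlinarith
  rcases le_total x 1.23 with h4 | h4
  · refine exp_le_mix_of_small (X := 1.89) (Z := x) hε one_pos hQ0 hm hC hx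
      ((monotone_tanh h4).trans t3) le_rfl (by linarith) h'' hg ?_
    norm_num
    nlinarith
  · refine exp_le_mix_of_mid hε one_pos hm hC (le_log_cosh_of_le one_pos
      (by linarith [Real.log_two_lt_d9]) hx (by norm_num) h4 hεQ ?_)
    have h1 := taylor_le_cosh 1.23
    have h2 : (0.6135) ≤ Real.log (Real.cosh 1.23) := by
      rw [Real.le_log_iff_exp_le (Real.cosh_pos _)]
      refine (exp_le_taylor (by norm_num) (by norm_num)).trans (le_trans ?_ h1)
      norm_num
    have h3 := hinv 1.23
    norm_num at h2 h3 ⊢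
    linarith

/-! ### Numerical bounds on Q - A, and the domination theorem -/

theorem le_log_of_sq {a b : ℝ} (h0 : 0 ≤ a) (h1 : a ≤ 1) (hb : 0 < b)
    (h : (1 + a + a ^ 2 / 2 + a ^ 3 / 6 + a ^ 4 / 24 + a ^ 5 / 100) ^ 2 ≤ b) :
    2 * a ≤ Real.log b := by
  rw [Real.le_log_iff_exp_le hb]
  refine le_trans ?_ h
  rw [show 2 * a = ((2 : ℕ) : ℝ) * a by norm_num, Real.exp_nat_mul]
  exact pow_le_pow_left₀ (Real.exp_pos a).le (exp_le_taylor h0 h1) 2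

theorem log_ge_tangent {c k : ℝ} (hc : 0 < c) (hk : 0 < k) :
    Real.log c + 1 - c / k ≤ Real.log k := by
  have := Real.one_sub_inv_le_log_of_pos (div_pos hk hc)
  rw [Real.log_div hk.ne' hc.ne', inv_div] at this
  linarith

/-- The tangent of log at c gives a bound affine in 1/n, sharp when n + 1 is close to c. -/
theorem log_mul_div_ge {a c l : ℝ} {n : ℕ} (hn : 1 ≤ n) (hc : 0 < c) (hl : l ≤ Real.log c) :
    (l + 1) / 2 + ((l + 1) / 2 - c / 2 + a) / n ≤
      1 / 2 * Real.log ((n : ℝ) + 1) * (((n : ℝ) + 1) / n) + a / n := by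
  have hn0 : (0 : ℝ) < n := by exact_mod_cast hn
  have h := log_ge_tangent hc (show (0 : ℝ) < (n : ℝ) + 1 by positivity)
  have h1 : l + 1 - c / ((n : ℝ) + 1) ≤ Real.log ((n : ℝ) + 1) := by linarith
  have h2 := mul_le_mul_of_nonneg_right h1 (show 0 ≤ ((n : ℝ) + 1) / n by positivity)
  have e : (l + 1 - c / ((n : ℝ) + 1)) * (((n : ℝ) + 1) / n) =
      (l + 1) + ((l + 1) - c) / n := by
    field_simp
    ring
  have e2 : ((l + 1) / 2 - c / 2 + a) / (n : ℝ) = ((l + 1) - c) / n / 2 + a / n := by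
    ring
  rw [e] at h2
  rw [e2]
  linarith

theorem excess_ge_of_two {a : ℝ} {n : ℕ} (hn : 1 ≤ n) (ha : 0.6931 ≤ a) :
    1.154 ≤ 1 / 2 * Real.log ((n : ℝ) + 1) * (((n : ℝ) + 1) / n) + a / n := by
  have hn0 : (0 : ℝ) < n := by exact_mod_cast hn
  have ha' : (0.6931 : ℝ) / n ≤ a / n := by gcongr
  have l3 : 2 * (0.545 : ℝ) ≤ Real.log 3 :=
    le_log_of_sq (by norm_num) (by norm_num) (by norm_num) (by norm_num)
  have l4 : (1.3862 : ℝ) ≤ Real.log 4 := by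
    rw [show (4 : ℝ) = 2 ^ 2 by norm_num, Real.log_pow]
    have := Real.log_two_gt_d9
    norm_num at this ⊢
    linarith
  -- For a = 0.6931 the minimum is about 1.155, at n = 3; hence tangents at n + 1 = 3 and n + 1 = 4
  -- on the two sides.
  rcases Nat.lt_or_ge n 3 with h | h
  · have h1 : (n : ℝ) ≤ 2 := by exact_mod_cast (by omega : n ≤ 2)
    have := log_mul_div_ge (a := 0.6931) hn (by norm_num) l3
    have h2 : (0.238 : ℝ) / 2 ≤ ((2 * 0.545 + 1) / 2 - 3 / 2 + 0.6931) / n := by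
      rw [div_le_div_iff₀ (by norm_num) hn0]
      norm_num
      linarith
    norm_num at this h2 ha' ⊢
    linarith
  · have h1 : (3 : ℝ) ≤ n := by exact_mod_cast h
    have := log_mul_div_ge (a := 0.6931) hn (by norm_num) l4
    have h2 : -(0.1138 : ℝ) / 3 ≤ ((1.3862 + 1) / 2 - 4 / 2 + 0.6931) / n := by
      rw [div_le_div_iff₀ (by norm_num) hn0]
      norm_num
      linarith
    norm_num at this h2 ha' ⊢
    linarith

theorem excess_ge_of_three_le {a : ℝ} {n : ℕ} (hn : 1 ≤ n) (ha : 1.79 ≤ a) :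
    1.42 ≤ 1 / 2 * Real.log ((n : ℝ) + 1) * (((n : ℝ) + 1) / n) + a / n := by
  have hn0 : (0 : ℝ) < n := by exact_mod_cast hn
  have ha' : (1.79 : ℝ) / n ≤ a / n := by gcongr
  have l5 : 2 * (0.8 : ℝ) ≤ Real.log 5 :=
    le_log_of_sq (by norm_num) (by norm_num) (by norm_num) (by norm_num)
  have l7 : 2 * (0.97 : ℝ) ≤ Real.log 7 :=
    le_log_of_sq (by norm_num) (by norm_num) (by norm_num) (by norm_num)
  rcases Nat.lt_or_ge n 5 with h | h
  · have h1 : (n : ℝ) ≤ 4 := by exact_mod_cast (by omega : n ≤ 4)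
    have := log_mul_div_ge (a := 1.79) hn (by norm_num) l5
    have h2 : (0.59 : ℝ) / 4 ≤ ((2 * 0.8 + 1) / 2 - 5 / 2 + 1.79) / n := by
      rw [div_le_div_iff₀ (by norm_num) hn0]
      norm_num
      linarith
    norm_num at this h2 ha' ⊢
    linarith
  · have h1 : (5 : ℝ) ≤ n := by exact_mod_cast h
    have := log_mul_div_ge (a := 1.79) hn (by norm_num) l7
    have h2 : -(0.24 : ℝ) / 5 ≤ ((2 * 0.97 + 1) / 2 - 7 / 2 + 1.79) / n := by
      rw [div_le_div_iff₀ (by norm_num) hn0]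
      norm_num
      linarith
    norm_num at this h2 ha' ⊢
    linarith

/-- The pairs `(d, A)` of an exponent and a logarithmic number of events in use: `d` is the number
of states, or `1` for two states. -/
def Admissible (d A : ℝ) : Prop :=
  d = 1 ∧ A = Real.log 2 ∨ 3 ≤ d ∧ 1.79 ≤ A ∧ d * Real.log 2 - 0.288 ≤ A

theorem Admissible.pos {d A : ℝ} (h : Admissible d A) : 0 < d := by
  rcases h with h | h <;> linarith [h.1]

theorem Admissible.le {d A : ℝ} (h : Admissible d A) : 0.6931 ≤ A := by
  rcases h with h | h
  · rw [h.2]; linarith [Real.log_two_gt_d9]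
  · linarith [h.2.1]

/-- Below √Q the gap is at most 0.84, and 0.84² < 1.154 - 0.4055. Above it, the cap on ε gives ε -
√Q ≤ 1 - 1.859/(n+1), with 1.859 = 1.359 + 1/2. The cuts at n = 13 and n = 16 balance this against
the growth of ½ log(n+1). -/
theorem sq_sub_le {Q K v : ℝ} {ε : ℝ} {n : ℕ} (hn : 1 ≤ n) (hQ : Q = K * ((n + 1) / n))
    (hQ0 : 1.847 ≤ Q) (hv : 1.154 ≤ v) (hv' : 1 / 2 * Real.log ((n : ℝ) + 1) ≤ v)
    (hε1 : √Q - 0.84 ≤ ε) (hε : ε ≤ √((n : ℝ) / (n + 1)) * (√K + 1)) :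
    (√Q - ε) ^ 2 ≤ v - 0.4055 := by
  have hn0 : (0 : ℝ) < n := by exact_mod_cast hn
  have hq : 1.359 ≤ √Q := Real.le_sqrt_of_sq_le (by norm_num at hQ0 ⊢; linarith)
  rcases le_total ε √Q with h | h
  · nlinarith
  have hK : K = (n : ℝ) / (n + 1) * Q := by rw [hQ]; field_simp
  have hs0 : 0 ≤ (n : ℝ) / (n + 1) := by positivity
  have e1 : √((n : ℝ) / (n + 1)) * √K = n / (n + 1) * √Q := by
    rw [hK, Real.sqrt_mul hs0, ← mul_assoc, Real.mul_self_sqrt hs0]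
  have e2 : √((n : ℝ) / (n + 1)) ≤ 1 - 1 / 2 * (1 / (n + 1)) := by
    rw [Real.sqrt_le_left (by
      have : 1 / ((n : ℝ) + 1) ≤ 1 := by rw [div_le_one (by positivity)]; linarith
      linarith)]
    have : (n : ℝ) / (n + 1) = 1 - 1 / (n + 1) := by field_simp; ring
    rw [this]
    nlinarith [sq_nonneg (1 / ((n : ℝ) + 1))]
  have e3 : (n : ℝ) / (n + 1) * √Q = √Q - √Q * (1 / (n + 1)) := by field_simp; ring
  have e4 : 1.359 * (1 / ((n : ℝ) + 1)) ≤ √Q * (1 / (n + 1)) := by gcongr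
  have hD : ε - √Q ≤ 1 - 1.859 * (1 / ((n : ℝ) + 1)) := by
    rw [mul_add, e1, e3, mul_one] at hε
    linarith
  have hD0 : 0 ≤ ε - √Q := by linarith
  have hsq : ∀ c, ε - √Q ≤ c → (√Q - ε) ^ 2 ≤ c ^ 2 := by
    intro c hc
    nlinarith
  have l16 : Real.log 16 = 4 * Real.log 2 := by
    rw [show (16 : ℝ) = 2 ^ 4 by norm_num, Real.log_pow]; norm_num
  have htan := log_ge_tangent (c := 16) (by norm_num) (show (0 : ℝ) < (n : ℝ) + 1 by positivity)
  rw [l16] at htan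
  have hl := Real.log_two_gt_d9
  rcases Nat.lt_or_ge n 13 with h1 | h1
  · have h2 : (n : ℝ) + 1 ≤ 13 := by exact_mod_cast (by omega : n + 1 ≤ 13)
    have h3 : (1 : ℝ) / 13 ≤ 1 / ((n : ℝ) + 1) := one_div_le_one_div_of_le (by positivity) h2
    have := hsq 0.857 (by linarith)
    norm_num at this hv ⊢
    linarith
  have h2 : (14 : ℝ) ≤ (n : ℝ) + 1 := by exact_mod_cast (by omega : 14 ≤ n + 1)
  have h3 : (16 : ℝ) / ((n : ℝ) + 1) ≤ 16 / 14 := by gcongr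
  rcases Nat.lt_or_ge n 16 with h4 | h4
  · have h5 : (n : ℝ) + 1 ≤ 16 := by exact_mod_cast (by omega : n + 1 ≤ 16)
    have h6 : (1 : ℝ) / 16 ≤ 1 / ((n : ℝ) + 1) := one_div_le_one_div_of_le (by positivity) h5
    have := hsq 0.884 (by linarith)
    norm_num at this hv h3 hl ⊢
    linarith
  · have h5 : (17 : ℝ) ≤ (n : ℝ) + 1 := by exact_mod_cast (by omega : 17 ≤ n + 1)
    have h6 : (16 : ℝ) / ((n : ℝ) + 1) ≤ 16 / 17 := by gcongr
    have h7 : 0 ≤ 1 / ((n : ℝ) + 1) := by positivity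
    have := hsq 1 (by linarith)
    rw [one_pow] at this
    norm_num at hv h6 hl ⊢
    linarith

/-- With z = K/n, one has Q = (n+1)z and the exponent contains ½ log(n+1) + z. After squaring, n + 1
cancels and e^(2z-1) ≥ 2z finishes. Here 0.56 = 1.68/3 and 0.5296 = 1 - 2 · 0.2352. -/
theorem three_mul_sqrt_le {Q K A L : ℝ} {n : ℕ} (hn : 1 ≤ n)
    (hL : 0 ≤ L) (hK : K = 1 / 2 * Real.log ((n : ℝ) + 1) + A + L) (hK0 : 0 ≤ K)
    (hQ : Q = K * ((n + 1) / n)) :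
    3 * √Q ≤ 1.68 * Real.exp (Q - A - 0.2352) := by
  have hn0 : (0 : ℝ) < n := by exact_mod_cast hn
  set k : ℝ := (n : ℝ) + 1 with hk
  have hk0 : 0 < k := by positivity
  set z := K / n with hz
  have hz0 : 0 ≤ z := by positivity
  have hQz : Q = k * z := by rw [hQ, hz]; ring
  have hv : Q - A - 0.2352 = 1 / 2 * Real.log k + L + (z - 0.2352) := by
    have : Q = K + z := by rw [hQ, hz, hk]; field_simp
    rw [this, hK]; ring
  have h1 : √Q ≤ 0.56 * Real.exp (Q - A - 0.2352) := by
    apply Real.sqrt_le_iff.2 ⟨by positivity, ?_⟩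
    have e : Real.exp (Q - A - 0.2352) ^ 2 = k * (Real.exp (2 * L) *
        (Real.exp 0.5296 * Real.exp (2 * z - 1))) := by
      rw [← Real.exp_nat_mul, hv]
      rw [show ((2 : ℕ) : ℝ) * (1 / 2 * Real.log k + L + (z - 0.2352)) =
        Real.log k + (2 * L + (0.5296 + (2 * z - 1))) by push_cast; ring]
      rw [Real.exp_add, Real.exp_log hk0, Real.exp_add (2 * L), Real.exp_add 0.5296]
    rw [mul_pow, e, hQz]
    have b1 : 1 ≤ Real.exp (2 * L) := Real.one_le_exp (by linarith)
    have b2 : 1.6 ≤ Real.exp 0.5296 := by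
      have := Real.quadratic_le_exp_of_nonneg (x := 0.5296) (by norm_num)
      norm_num at this ⊢
      linarith
    have b3 : 2 * z ≤ Real.exp (2 * z - 1) := by
      have := Real.add_one_le_exp (2 * z - 1)
      linarith
    have b4 : 1 * (1.6 * (2 * z)) ≤ Real.exp (2 * L) *
        (Real.exp 0.5296 * Real.exp (2 * z - 1)) := by gcongr
    have b5 := mul_le_mul_of_nonneg_left b4 hk0.le
    nlinarith [mul_nonneg hk0.le hz0]
  linarith

/-- The lower bound for the mixtures: they dominate the exponential of the excess of a deviation
over its bound. -/
theorem exp_le_mix {E : ℝ → ℝ} {d A L K Q ε m : ℝ} {n : ℕ} (hn : 1 ≤ n) (hA : Admissible d A)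
    (hL : 0 ≤ L) (hK : K = 1 / 2 * Real.log ((n : ℝ) + 1) + A + L) (hQ : Q = K * ((n + 1) / n))
    (hε : 0 < ε) (hεK : ε ≤ √((n : ℝ) / (n + 1)) * (√K + 1))
    (hJ : ∀ μ, 0 < μ → Real.exp (μ * m - A - μ ^ 2) ≤ E μ)
    (hC : ∀ μ, 0 < μ → Real.exp (d * Real.log (Real.cosh (μ * m / d)) - μ ^ 2) ≤ E μ) :
    ENNReal.ofReal (Real.exp (ε * (m - 2 * √Q))) ≤ mix E ε := by
  have hn0 : (0 : ℝ) < n := by exact_mod_cast hn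
  have hlog : 0 ≤ Real.log ((n : ℝ) + 1) := Real.log_nonneg (by linarith)
  have hA' := hA.le
  have hK0 : 0 ≤ K := by linarith
  have hv : Q - A = 1 / 2 * Real.log ((n : ℝ) + 1) * (((n : ℝ) + 1) / n) + A / n +
      L * (((n : ℝ) + 1) / n) := by
    rw [hQ, hK]; field_simp; ring
  have hLn : 0 ≤ L * (((n : ℝ) + 1) / n) := by positivity
  have hv1 : 1.154 ≤ Q - A := by
    linarith [excess_ge_of_two hn hA']
  have hv2 : 1 / 2 * Real.log ((n : ℝ) + 1) ≤ Q - A := by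
    have h1 : 1 ≤ ((n : ℝ) + 1) / n := by rw [le_div_iff₀ hn0]; linarith
    have h2 : 0 ≤ A / n := by positivity
    have h3 := mul_le_mul_of_nonneg_left h1 (show 0 ≤ 1 / 2 * Real.log ((n : ℝ) + 1) by positivity)
    linarith
  have hQ1 : 1.847 ≤ Q := by linarith
  have hq : 1.359 ≤ √Q := Real.le_sqrt_of_sq_le (by norm_num at hQ1 ⊢; linarith)
  have hQd : d * Real.log 2 + 1.13 ≤ Q := by
    rcases hA with ⟨h1, h2⟩ | ⟨h1, h2, h3⟩
    · rw [h1, one_mul, ← h2]; linarith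
    · linarith [excess_ge_of_three_le hn h2]
  -- Three regimes: tilt near or above the optimum √Q; smaller tilt with deviation above the
  -- threshold 2√Q; smaller tilt with deviation below it.
  rcases le_total (√Q - 0.84) ε with h | h
  · exact exp_le_mix_of_near hε (by linarith) hJ (sq_sub_le hn hQ hQ1 hv1 hv2 h hεK)
  rcases le_total (2 * √Q) m with hm | hm
  · exact exp_le_mix_of_large hε hA.pos (by linarith) hm hJ hC (by linarith) h
      (three_mul_sqrt_le hn hL hK hK0 hQ)
  · rcases hA with ⟨h1, h2⟩ | ⟨h1, h2, h3⟩
    · subst h1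
      exact exp_le_mix_of_small_of_two hε hQ1 hm hC h
    · exact exp_le_mix_of_small_of_three_le hε h1 hQd hm hC h

/-! ### The exponential supermartingale of one pair -/

theorem two_point_mgf_le {q : ℝ} (h0 : 0 ≤ q) (h1 : q ≤ 1) (u : ℝ) :
    q * Real.exp (u * (1 - q)) + (1 - q) * Real.exp (u * (0 - q)) ≤ Real.exp (u ^ 2 / 8) := by
  let μ : Measure ℝ :=
    ENNReal.ofReal q • Measure.dirac 1 + ENNReal.ofReal (1 - q) • Measure.dirac 0
  have hμ : IsProbabilityMeasure μ := ⟨by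
    simp [μ, ← ENNReal.ofReal_add h0 (sub_nonneg.2 h1)]⟩
  have hint : ∀ f : ℝ → ℝ, ∫ x, f x ∂μ = q * f 1 + (1 - q) * f 0 := by
    intro f
    rw [integral_add_measure, integral_smul_measure, integral_smul_measure, integral_dirac,
      integral_dirac, ENNReal.toReal_ofReal h0, ENNReal.toReal_ofReal (sub_nonneg.2 h1)]
    · simp
    · exact (integrable_dirac (by simp)).smul_measure ENNReal.ofReal_ne_top
    · exact (integrable_dirac (by simp)).smul_measure ENNReal.ofReal_ne_top
  have hb : ∀ᵐ x ∂μ, id x ∈ Set.Icc (0 : ℝ) 1 := by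
    rw [ae_add_measure_iff]
    constructor
    · refine Measure.ae_smul_measure ?_ _
      rw [ae_dirac_eq]; simp
    · refine Measure.ae_smul_measure ?_ _
      rw [ae_dirac_eq]; simp
  have h := (ProbabilityTheory.hasSubgaussianMGF_of_mem_Icc (μ := μ) aemeasurable_id hb).mgf_le u
  rw [ProbabilityTheory.mgf, hint, hint] at h
  simp only [id_eq, mul_one, mul_zero, add_zero] at h
  refine h.trans (le_of_eq ?_)
  congr 1
  simp
  ring

section Pair

variable {S : Type*} [Fintype S]

/-- The total number of observations. -/
def tot (N : S → ℕ) : ℕ := ∑ x, N x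

/-- The deviation of the number of visits to `x` from its compensator. -/
def dev (p : S → ℝ) (N : S → ℕ) (x : S) : ℝ := N x - tot N * p x

/-- The total variation deviation. -/
noncomputable def tvDev (p : S → ℝ) (N : S → ℕ) : ℝ := 1 / 2 * ∑ x, |dev p N x|

theorem sum_dev {p : S → ℝ} (hp : ∑ x, p x = 1) (N : S → ℕ) : ∑ x, dev p N x = 0 := by
  simp [dev, tot, Finset.sum_sub_distrib, ← Finset.mul_sum, hp]

/-- The sum over subsets expands the product of the 1 + e^(uv) = 2 cosh(uv/2) e^(uv/2), and the last
factors multiply to 1 because v sums to zero. -/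
theorem sum_exp_eq_prod_cosh {v : S → ℝ} (hv : ∑ x, v x = 0) (u : ℝ) :
    ∑ B : Finset S, Real.exp (u * ∑ x ∈ B, v x) =
      2 ^ Fintype.card S * ∏ x, Real.cosh (u * |v x| / 2) := by
  have h1 : ∀ x, 1 + Real.exp (u * v x) =
      2 * Real.cosh (u * |v x| / 2) * Real.exp (u * v x / 2) := by
    intro x
    have : Real.cosh (u * |v x| / 2) = Real.cosh (u * v x / 2) := by
      rcases abs_choice (v x) with h | h
      · rw [h]
      · rw [h, ← Real.cosh_neg]; ring_nf
    rw [this, Real.cosh_eq]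
    have e1 : Real.exp (u * v x) = Real.exp (u * v x / 2) * Real.exp (u * v x / 2) := by
      rw [← Real.exp_add]; ring_nf
    have e2 : Real.exp (-(u * v x / 2)) * Real.exp (u * v x / 2) = 1 := by
      rw [← Real.exp_add]; simp
    rw [e1]
    linarith
  have h2 : ∏ x, Real.exp (u * v x / 2) = 1 := by
    rw [← Real.exp_sum, ← Finset.sum_div, ← Finset.mul_sum, hv]; simp
  calc ∑ B : Finset S, Real.exp (u * ∑ x ∈ B, v x)
      = ∑ B ∈ (Finset.univ : Finset S).powerset, ∏ x ∈ B, Real.exp (u * v x) := by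
        rw [Finset.powerset_univ]
        refine Finset.sum_congr rfl fun B _ => ?_
        rw [Finset.mul_sum, Real.exp_sum]
    _ = ∏ x, (1 + Real.exp (u * v x)) := (Finset.prod_one_add _).symm
    _ = _ := by
        simp_rw [h1]
        rw [Finset.prod_mul_distrib, Finset.prod_mul_distrib, h2, mul_one, Finset.prod_const,
          Finset.card_univ]

variable [DecidableEq S]

/-- The nonempty proper subsets. -/
def properSets (S : Type*) [Fintype S] [DecidableEq S] : Finset (Finset S) :=
  Finset.univ \ {∅, Finset.univ}

theorem card_properSets [Nonempty S] : ((properSets S).card : ℝ) = 2 ^ Fintype.card S - 2 := by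
  have h : (∅ : Finset S) ≠ Finset.univ := Finset.univ_nonempty.ne_empty.symm
  have h1 : ({∅, Finset.univ} : Finset (Finset S)).card = 2 := Finset.card_pair h
  have h2 := Finset.card_sdiff_add_card_eq_card
    (Finset.subset_univ ({∅, Finset.univ} : Finset (Finset S)))
  rw [h1, Finset.card_univ, Fintype.card_finset] at h2
  have h3 : ((properSets S).card : ℝ) + 2 = 2 ^ Fintype.card S := by
    unfold properSets; exact_mod_cast h2
  linarith

theorem sum_properSets [Nonempty S] (f : Finset S → ℝ) :
    ∑ B ∈ properSets S, f B = ∑ B, f B - f ∅ - f Finset.univ := by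
  have h : (∅ : Finset S) ≠ Finset.univ := Finset.univ_nonempty.ne_empty.symm
  have h2 := Finset.sum_sdiff (f := f)
    (Finset.subset_univ ({∅, Finset.univ} : Finset (Finset S)))
  rw [Finset.sum_pair h] at h2
  unfold properSets
  linarith

/-- The average over the events of the exponential supermartingales of a pair. -/
noncomputable def tilt (p : S → ℝ) (N : S → ℕ) (u : ℝ) : ℝ :=
  Real.exp (-(u ^ 2 * tot N / 8)) *
    (1 / (properSets S).card * ∑ B ∈ properSets S, Real.exp (u * ∑ x ∈ B, dev p N x))

theorem tilt_nonneg (p : S → ℝ) (N : S → ℕ) (u : ℝ) : 0 ≤ tilt p N u := by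
  unfold tilt; positivity

theorem continuous_tilt (p : S → ℝ) (N : S → ℕ) : Continuous (tilt p N) := by
  unfold tilt; fun_prop

theorem tilt_zero (p : S → ℝ) (h : (properSets S).Nonempty) (u : ℝ) :
    tilt p (fun _ => 0) u = 1 := by
  have : ((properSets S).card : ℝ) ≠ 0 := by exact_mod_cast h.card_pos.ne'
  simp [tilt, tot, dev, this]

theorem tot_add_single (N : S → ℕ) (x : S) : tot (N + Pi.single x 1) = tot N + 1 := by
  simp [tot, Finset.sum_add_distrib]

theorem sum_dev_add_single (p : S → ℝ) (N : S → ℕ) (x : S) (B : Finset S) :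
    ∑ y ∈ B, dev p (N + Pi.single x 1) y =
      ∑ y ∈ B, dev p N y + ((if x ∈ B then 1 else 0) - ∑ y ∈ B, p y) := by
  have h : ∀ y, dev p (N + Pi.single x 1) y =
      dev p N y + ((if y = x then 1 else 0) - p y) := by
    intro y
    simp only [dev, tot_add_single, Pi.add_apply, Pi.single_apply]
    push_cast
    ring
  simp [h, Finset.sum_add_distrib, Finset.sum_sub_distrib]

theorem sum_mul_exp_le {p : S → ℝ} (h0 : ∀ x, 0 ≤ p x) (h1 : ∑ x, p x = 1) (B : Finset S)
    (u : ℝ) : ∑ x, p x * Real.exp (u * ((if x ∈ B then 1 else 0) - ∑ y ∈ B, p y)) ≤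
      Real.exp (u ^ 2 / 8) := by
  set q := ∑ y ∈ B, p y with hq
  have hq0 : 0 ≤ q := Finset.sum_nonneg fun x _ => h0 x
  have hc : ∑ y ∈ Bᶜ, p y = 1 - q := by
    rw [← h1, hq, ← Finset.sum_add_sum_compl B]; ring
  have hq1 : q ≤ 1 := by
    have : 0 ≤ ∑ y ∈ Bᶜ, p y := Finset.sum_nonneg fun x _ => h0 x
    linarith
  refine le_trans (le_of_eq ?_) (two_point_mgf_le hq0 hq1 u)
  rw [← Finset.sum_add_sum_compl B]
  congr 1
  · rw [hq, Finset.sum_mul]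
    exact Finset.sum_congr rfl fun x hx => by simp [hx]
  · rw [← hc, Finset.sum_mul]
    exact Finset.sum_congr rfl fun x hx => by simp [Finset.mem_compl.1 hx]

/-- The supermartingale property: for each event the increment is a centred Bernoulli variable, and
Hoeffding's lemma is paid for by the factor e^(-u²/8). -/
theorem sum_mul_tilt_le {p : S → ℝ} (h0 : ∀ x, 0 ≤ p x) (h1 : ∑ x, p x = 1) (N : S → ℕ)
    (u : ℝ) : ∑ x, p x * tilt p (N + Pi.single x 1) u ≤ tilt p N u := by
  have e : ∑ x, p x * tilt p (N + Pi.single x 1) u =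
      Real.exp (-(u ^ 2 * (tot N + 1) / 8)) * (1 / (properSets S).card *
        ∑ B ∈ properSets S, Real.exp (u * ∑ x ∈ B, dev p N x) *
          ∑ x, p x * Real.exp (u * ((if x ∈ B then 1 else 0) - ∑ y ∈ B, p y))) := by
    have hx : ∀ B x, Real.exp (u * (∑ y ∈ B, dev p N y +
        ((if x ∈ B then 1 else 0) - ∑ y ∈ B, p y))) = Real.exp (u * ∑ y ∈ B, dev p N y) *
          Real.exp (u * ((if x ∈ B then 1 else 0) - ∑ y ∈ B, p y)) := fun B x => by
      rw [mul_add, Real.exp_add]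
    simp_rw [tilt, tot_add_single, sum_dev_add_single, hx]
    generalize hf : (fun B => Real.exp (u * ∑ y ∈ B, dev p N y)) = f
    generalize hg : (fun (B : Finset S) (x : S) =>
      Real.exp (u * ((if x ∈ B then 1 else 0) - ∑ y ∈ B, p y))) = g
    have hf' : ∀ B, Real.exp (u * ∑ y ∈ B, dev p N y) = f B := fun B => congrFun hf B
    have hg' : ∀ (B : Finset S) (x : S), Real.exp (u * ((if x ∈ B then 1 else 0) -
      ∑ y ∈ B, p y)) = g B x := fun B x => congrFun (congrFun hg B) x
    simp_rw [hf', hg', Finset.mul_sum]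
    rw [Finset.sum_comm]
    refine Finset.sum_congr rfl fun B _ => Finset.sum_congr rfl fun x _ => ?_
    push_cast
    ring
  rw [e]
  have : Real.exp (-(u ^ 2 * tot N / 8)) =
      Real.exp (-(u ^ 2 * (tot N + 1) / 8)) * Real.exp (u ^ 2 / 8) := by
    rw [← Real.exp_add]; ring_nf
  rw [tilt, this, mul_assoc]
  refine mul_le_mul_of_nonneg_left ?_ (Real.exp_pos _).le
  rw [mul_left_comm]
  refine mul_le_mul_of_nonneg_left ?_ (by positivity)
  rw [Finset.mul_sum (properSets S)]
  refine Finset.sum_le_sum fun B _ => ?_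
  rw [mul_comm (Real.exp (u ^ 2 / 8))]
  exact mul_le_mul_of_nonneg_left (sum_mul_exp_le h0 h1 B u) (Real.exp_pos _).le

/-- Total variation is attained on the set of positive deviations. As they sum to zero, this set is
nonempty and proper unless all deviations vanish, and then any singleton works. -/
theorem exists_properSet_sum_dev {p : S → ℝ} (h1 : ∑ x, p x = 1) (N : S → ℕ)
    (h : 2 ≤ Fintype.card S) : ∃ B ∈ properSets S, ∑ x ∈ B, dev p N x = tvDev p N := by
  have hs := sum_dev h1 N
  have hmem : ∀ B : Finset S, B ∈ properSets S ↔ B ≠ ∅ ∧ B ≠ Finset.univ := by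
    intro B; simp [properSets]
  have hsplit : ∀ B : Finset S, (∀ x ∈ B, 0 ≤ dev p N x) → (∀ x ∉ B, dev p N x ≤ 0) →
      ∑ x ∈ B, dev p N x = tvDev p N := by
    intro B hB hB'
    rw [tvDev, ← Finset.sum_add_sum_compl B]
    rw [← Finset.sum_add_sum_compl B] at hs
    have e1 : ∑ x ∈ B, |dev p N x| = ∑ x ∈ B, dev p N x :=
      Finset.sum_congr rfl fun x hx => abs_of_nonneg (hB x hx)
    have e2 : ∑ x ∈ Bᶜ, |dev p N x| = -∑ x ∈ Bᶜ, dev p N x := by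
      rw [← Finset.sum_neg_distrib]
      exact Finset.sum_congr rfl fun x hx => abs_of_nonpos (hB' x (Finset.mem_compl.1 hx))
    linarith
  by_cases hz : ∀ x, dev p N x = 0
  · have : Nontrivial S := Fintype.one_lt_card_iff_nontrivial.1 h
    obtain ⟨a, b, hab⟩ := exists_pair_ne S
    refine ⟨{a}, (hmem _).2 ⟨by simp, fun he => ?_⟩, hsplit _ (by simp [hz]) (by simp [hz])⟩
    have : b ∈ ({a} : Finset S) := he ▸ Finset.mem_univ b
    exact hab (Finset.mem_singleton.1 this).symm
  · refine ⟨Finset.univ.filter fun x => 0 < dev p N x, (hmem _).2 ⟨fun he => hz ?_,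
      fun he => hz ?_⟩, hsplit _ (fun x hx => (Finset.mem_filter.1 hx).2.le)
      (fun x hx => by simpa using hx)⟩
    · have hle : ∀ x ∈ Finset.univ, dev p N x ≤ 0 := by
        intro x _
        by_contra hx
        have : x ∈ Finset.univ.filter fun x => 0 < dev p N x := by simpa using hx
        rw [he] at this
        simp at this
      intro x
      exact (Finset.sum_eq_zero_iff_of_nonpos hle).1 hs x (Finset.mem_univ x)
    · have hle : ∀ x ∈ Finset.univ, 0 ≤ dev p N x := by
        intro x _
        have : x ∈ Finset.univ.filter fun x => 0 < dev p N x := by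
          rw [he]; exact Finset.mem_univ x
        exact (Finset.mem_filter.1 this).2.le
      intro x
      exact (Finset.sum_eq_zero_iff_of_nonneg hle).1 hs x (Finset.mem_univ x)

/-- The bound of a tilt by its largest term. -/
theorem exp_le_tilt {p : S → ℝ} (h1 : ∑ x, p x = 1) (N : S → ℕ) (h : 2 ≤ Fintype.card S) (u : ℝ) :
    Real.exp (u * tvDev p N - Real.log (2 ^ Fintype.card S - 2) - u ^ 2 * tot N / 8) ≤
      tilt p N u := by
  have : Nonempty S := Fintype.card_pos_iff.1 (by omega)
  obtain ⟨B, hB, hBd⟩ := exists_properSet_sum_dev h1 N h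
  have hc : 0 < ((properSets S).card : ℝ) := by exact_mod_cast Finset.card_pos.2 ⟨B, hB⟩
  rw [tilt, ← card_properSets]
  have e : u * tvDev p N - Real.log (properSets S).card - u ^ 2 * tot N / 8 =
      -(u ^ 2 * tot N / 8) + (u * tvDev p N - Real.log (properSets S).card) := by ring
  rw [e, Real.exp_add]
  refine mul_le_mul_of_nonneg_left ?_ (Real.exp_pos _).le
  rw [Real.exp_sub, Real.exp_log hc, div_eq_inv_mul, ← one_div, ← hBd]
  exact mul_le_mul_of_nonneg_left
    (Finset.single_le_sum (f := fun B => Real.exp (u * ∑ x ∈ B, dev p N x))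
      (fun _ _ => (Real.exp_pos _).le) hB) (by positivity)

theorem convexOn_log_cosh : ConvexOn ℝ Set.univ (fun x => Real.log (Real.cosh x)) := by
  have hd : ∀ z, HasDerivAt (fun z => Real.log (Real.cosh z)) (Real.tanh z) z := fun z => by
    refine HasDerivAt.congr_deriv ((Real.hasDerivAt_cosh z).log (Real.cosh_pos z).ne') ?_
    rw [Real.tanh_eq_sinh_div_cosh z]
  refine Monotone.convexOn_univ_of_deriv (fun z => (hd z).differentiableAt) ?_
  rw [funext fun z => (hd z).deriv]
  exact monotone_tanh

/-- Keeping all events: with T the product of the cosh, the average is (2^S T - 2)/(2^S - 2) ≥ T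
because T ≥ 1. Jensen's inequality for log cosh then brings in the total variation, without losing
log(2^S - 2). -/
theorem exp_log_cosh_le_tilt {p : S → ℝ} (h1 : ∑ x, p x = 1) (N : S → ℕ)
    (h : 2 ≤ Fintype.card S) {u : ℝ} :
    Real.exp (Fintype.card S * Real.log (Real.cosh (u * tvDev p N / Fintype.card S)) -
      u ^ 2 * tot N / 8) ≤ tilt p N u := by
  have hne : Nonempty S := Fintype.card_pos_iff.1 (by omega)
  have hS : (0 : ℝ) < Fintype.card S := by exact_mod_cast (by omega : 0 < Fintype.card S)
  rw [sub_eq_neg_add, Real.exp_add, tilt]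
  refine mul_le_mul_of_nonneg_left ?_ (Real.exp_pos _).le
  rw [sum_properSets, sum_exp_eq_prod_cosh (sum_dev h1 N), card_properSets, sum_dev h1 N]
  set T := ∏ x, Real.cosh (u * |dev p N x| / 2) with hT
  have hT1 : 1 ≤ T := by
    rw [hT, ← Finset.prod_const_one (s := (Finset.univ : Finset S))]
    exact Finset.prod_le_prod (fun _ _ => zero_le_one) fun x _ => Real.one_le_cosh _
  have h4 : (4 : ℝ) ≤ 2 ^ Fintype.card S := by
    calc (4 : ℝ) = 2 ^ 2 := by norm_num
      _ ≤ _ := pow_le_pow_right₀ (by norm_num) h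
  have h5 : T ≤ 1 / (2 ^ Fintype.card S - 2) * (2 ^ Fintype.card S * T - Real.exp (u * ∑ x ∈ ∅, dev p N x) -
      Real.exp (u * 0)) := by
    rw [one_div, ← div_eq_inv_mul, le_div_iff₀ (by linarith)]
    simp
    linarith
  refine le_trans ?_ h5
  have hJ := convexOn_log_cosh.map_sum_le (t := Finset.univ) (w := fun _ : S => 1 / (Fintype.card S : ℝ))
    (p := fun x => u * |dev p N x| / 2) (fun _ _ => by positivity) (by simp) (fun _ _ => trivial)
  simp only [smul_eq_mul, ← Finset.mul_sum] at hJ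
  have e : 1 / (Fintype.card S : ℝ) * ∑ x, u * |dev p N x| / 2 = u * tvDev p N / Fintype.card S := by
    rw [tvDev, ← Finset.sum_div, ← Finset.mul_sum]; ring
  rw [e, one_div, ← div_eq_inv_mul, le_div_iff₀ hS, mul_comm] at hJ
  rw [← Real.log_prod (fun x _ => (Real.cosh_pos _).ne')] at hJ
  refine (Real.exp_le_exp.2 hJ).trans ?_
  rw [Real.exp_log (by linarith)]

/-- An event and its complement have opposite deviations, so their average is a single cosh. Since
cosh v ≥ cosh²(v/2), this improves on exponent 2. -/
theorem exp_log_cosh_le_tilt_of_two {p : S → ℝ} (h1 : ∑ x, p x = 1) (N : S → ℕ)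
    (h : Fintype.card S = 2) {u : ℝ} :
    Real.exp (1 * Real.log (Real.cosh (u * tvDev p N / 1)) - u ^ 2 * tot N / 8) ≤ tilt p N u := by
  have hne : Nonempty S := Fintype.card_pos_iff.1 (by omega)
  rw [sub_eq_neg_add, Real.exp_add, tilt]
  refine mul_le_mul_of_nonneg_left ?_ (Real.exp_pos _).le
  rw [one_mul, div_one, Real.exp_log (Real.cosh_pos _), card_properSets, h]
  obtain ⟨B, hB, hBd⟩ := exists_properSet_sum_dev h1 N h.ge
  have hBc : ∑ x ∈ Bᶜ, dev p N x = -tvDev p N := by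
    have := Finset.sum_add_sum_compl B (dev p N)
    rw [sum_dev h1 N] at this
    linarith
  have hB' : Bᶜ ∈ properSets S := by
    simp only [properSets, Finset.mem_sdiff, Finset.mem_univ, true_and, Finset.mem_insert,
      Finset.mem_singleton, not_or] at hB ⊢
    exact ⟨fun he => hB.2 (by simpa using congrArg compl he),
      fun he => hB.1 (by simpa using congrArg compl he)⟩
  have hne : B ≠ Bᶜ := by
    intro he
    obtain ⟨a⟩ := hne
    have h1 : a ∈ B ↔ a ∈ Bᶜ := by rw [← he]
    rw [Finset.mem_compl] at h1
    tauto
  have hsub : ({B, Bᶜ} : Finset (Finset S)) ⊆ properSets S := by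
    intro C hC
    rcases Finset.mem_insert.1 hC with rfl | hC
    · exact hB
    · rw [Finset.mem_singleton.1 hC]; exact hB'
  have := Finset.sum_le_sum_of_subset_of_nonneg hsub
    (f := fun B => Real.exp (u * ∑ x ∈ B, dev p N x)) fun _ _ _ => (Real.exp_pos _).le
  rw [Finset.sum_pair hne, hBd, hBc, mul_neg] at this
  rw [Real.cosh_eq]
  norm_num
  linarith

end Pair

/-! ### Domination for a single pair -/

theorem mix_comp_mul (E : ℝ → ℝ) (c x : ℝ) : mix (fun μ => E (c * μ)) x = mix E (c * x) := by
  simp only [mix, mul_assoc]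

/-- The logarithmic term in the bound on the deviation after `n` observations. -/
noncomputable def rate (k : ℕ) (L : ℝ) (n : ℕ) : ℝ :=
  1 / 2 * Real.log ((n : ℝ) + 1) + Real.log (2 ^ k - 2) + L

theorem log_ge_of_two_le {k : ℕ} (hk : 2 ≤ k) : Real.log 2 ≤ Real.log (2 ^ k - 2) := by
  apply Real.log_le_log (by norm_num)
  have : (2 : ℝ) ^ 2 ≤ 2 ^ k := pow_le_pow_right₀ (by norm_num) hk
  linarith

/-- From log b ≤ log a + b/a - 1: the growth of the half logarithm is absorbed because log(2^k - 2)
≥ log 2 > 1/2. -/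
theorem rate_div_anti {k : ℕ} {L : ℝ} (hk : 2 ≤ k) (hL : 0 ≤ L) {n n₁ : ℕ} (h : n ≤ n₁) :
    rate k L n₁ / (n₁ + 1) ≤ rate k L n / (n + 1) := by
  have h' : (n : ℝ) + 1 ≤ (n₁ : ℝ) + 1 := by exact_mod_cast Nat.succ_le_succ h
  set a : ℝ := (n : ℝ) + 1 with ha
  set b : ℝ := (n₁ : ℝ) + 1 with hb
  have ha0 : 1 ≤ a := by rw [ha]; linarith [Nat.cast_nonneg (α := ℝ) n]
  have hlog : Real.log b ≤ Real.log a + (b / a - 1) := by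
    have := Real.log_le_sub_one_of_pos (div_pos (show 0 < b by linarith) (show 0 < a by linarith))
    rw [Real.log_div (by linarith) (by linarith)] at this
    linarith
  have hA := log_ge_of_two_le hk
  have h2 := Real.log_two_gt_d9
  have hla := Real.log_nonneg ha0
  rw [div_le_div_iff₀ (by linarith) (by linarith)]
  unfold rate
  rw [← ha, ← hb]
  have e : (b / a - 1) * a = b - a := by field_simp
  have := mul_le_mul_of_nonneg_right hlog (show 0 ≤ a by linarith)
  nlinarith [mul_nonneg (sub_nonneg.2 h') (show 0 ≤ Real.log (2 ^ k - 2) - 1 / 2 by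
    norm_num at h2 ⊢; linarith), mul_nonneg (sub_nonneg.2 h') hla, mul_nonneg (sub_nonneg.2 h') hL]

theorem one_le_rate {k : ℕ} {L : ℝ} (hk : 2 ≤ k) (hL : 0 ≤ L) {n : ℕ} (hn : 1 ≤ n) :
    1 ≤ rate k L n := by
  have h1 : (2 : ℝ) ≤ (n : ℝ) + 1 := by exact_mod_cast Nat.succ_le_succ hn
  have h2 := Real.log_le_log (by norm_num) h1
  have hA := log_ge_of_two_le hk
  have h3 := Real.log_two_gt_d9
  norm_num at h3
  unfold rate
  linarith

section Pair

variable {S : Type*} [Fintype S]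

/-- The excess of the deviation of a pair over its bound. -/
noncomputable def excess (p : S → ℝ) (L : ℝ) (N : S → ℕ) : ℝ :=
  if tot N = 0 then 0 else
    tvDev p N - √(2 * (tot N + 1) * rate (Fintype.card S) L (tot N)) / 2

/-- The largest tilt in use when `n` is the largest number of observations. -/
noncomputable def maxTilt (k : ℕ) (L : ℝ) (n : ℕ) : ℝ := √(8 / ((n : ℝ) + 1)) * (√(rate k L n) + 1)

/-- Makes the cap of the most observed pair of a class valid for all its pairs, so that one tilt
serves the whole product. -/
theorem maxTilt_anti {k : ℕ} {L : ℝ} (hk : 2 ≤ k) (hL : 0 ≤ L) {n n₁ : ℕ} (h : n ≤ n₁) :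
    maxTilt k L n₁ ≤ maxTilt k L n := by
  have h' : (n : ℝ) + 1 ≤ (n₁ : ℝ) + 1 := by exact_mod_cast Nat.succ_le_succ h
  have e : ∀ j : ℕ, maxTilt k L j = √(8 * (rate k L j / (j + 1))) + √(8 / ((j : ℝ) + 1)) := by
    intro j
    rw [maxTilt, mul_add, mul_one, ← Real.sqrt_mul (by positivity)]
    congr 2
    ring
  rw [e, e]
  have := rate_div_anti hk hL h
  gcongr

/-- For k ≥ 3, 2^k - 2 is at least 6 and at least (3/4) 2^k; moreover 1.79 < log 6 and log(4/3) <
0.288. -/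
theorem admissible_of_three_le {k : ℕ} (hk : 3 ≤ k) :
    Admissible k (Real.log (2 ^ k - 2)) := by
  have h8 : (2 : ℝ) ^ 3 ≤ 2 ^ k := pow_le_pow_right₀ (by norm_num) hk
  refine Or.inr ⟨by exact_mod_cast hk, ?_, ?_⟩
  · have h6 : 2 * (0.895 : ℝ) ≤ Real.log 6 :=
      le_log_of_sq (by norm_num) (by norm_num) (by norm_num) (by norm_num)
    have := Real.log_le_log (by norm_num) (show (6 : ℝ) ≤ 2 ^ k - 2 by linarith)
    norm_num at h6 ⊢
    linarith
  · rw [Real.le_log_iff_exp_le (by linarith), Real.exp_sub, mul_comm, Real.exp_mul,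
      Real.exp_log (by norm_num), Real.rpow_natCast, div_le_iff₀ (Real.exp_pos _)]
    have h1 : (4 : ℝ) / 3 ≤ Real.exp 0.288 := by
      refine le_trans ?_ (Real.sum_le_exp_of_nonneg (by norm_num) 4)
      norm_num [Finset.sum_range_succ, Nat.factorial]
    nlinarith

variable [DecidableEq S]

/-- Rescaling tilts by c = √(8/n) turns u²n/8 into μ² and the bound on the deviation into 2√Q. Then
`exp_le_mix` applies, with d = 1 for two states and d the number of states otherwise. -/
theorem exp_excess_le_mix {p : S → ℝ} (h1 : ∑ x, p x = 1) (hS : 2 ≤ Fintype.card S) {L : ℝ}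
    (hL : 0 ≤ L) (N : S → ℕ) (hN : 1 ≤ tot N) {l : ℝ} (hl : 0 < l)
    (hl' : l ≤ maxTilt (Fintype.card S) L (tot N)) :
    ENNReal.ofReal (Real.exp (l * excess p L N)) ≤ mix (tilt p N) l := by
  set n := tot N with hn
  have hn0 : (0 : ℝ) < n := by exact_mod_cast hN
  set K := rate (Fintype.card S) L n with hK
  have hK1 : 1 ≤ K := one_le_rate hS hL hN
  set c : ℝ := √(8 / n) with hc
  have hc0 : 0 < c := Real.sqrt_pos.2 (by positivity)
  have hc2 : c ^ 2 * n = 8 := by rw [hc, Real.sq_sqrt (by positivity)]; field_simp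
  have hcl : c * (l / c) = l := by field_simp
  have hmix : mix (fun μ => tilt p N (c * μ)) (l / c) = mix (tilt p N) l := by
    rw [mix_comp_mul, hcl]
  rw [← hmix]
  have hex : l * excess p L N = (l / c) * (c * tvDev p N - 2 * √(K * ((n + 1) / n))) := by
    rw [excess, if_neg (by omega), ← hn, ← hK]
    have e1 : √(2 * ((n : ℝ) + 1) * K) = 4 / c * √(K * ((n + 1) / n)) := by
      have h4 : 4 / c = √(16 / c ^ 2) := by
        rw [Real.sqrt_div (by norm_num), Real.sqrt_sq hc0.le,
          show (16 : ℝ) = 4 ^ 2 by norm_num, Real.sqrt_sq (by norm_num)]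
      rw [h4, ← Real.sqrt_mul (by positivity)]
      congr 1
      have : c ^ 2 = 8 / n := by rw [hc, Real.sq_sqrt (by positivity)]
      rw [this]
      field_simp
      norm_num
    rw [e1]
    field_simp
    ring
  rw [hex]
  have hε : l / c ≤ √((n : ℝ) / (n + 1)) * (√K + 1) := by
    rw [div_le_iff₀ hc0]
    refine hl'.trans (le_of_eq ?_)
    rw [maxTilt, mul_right_comm, hc, ← Real.sqrt_mul (by positivity)]
    congr 2
    field_simp
  have hsq : ∀ μ : ℝ, μ ^ 2 = (c * μ) ^ 2 * n / 8 := by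
    intro μ
    rw [mul_pow, mul_right_comm, hc2]; ring
  have hJ : ∀ μ, 0 < μ → Real.exp (μ * (c * tvDev p N) - Real.log (2 ^ Fintype.card S - 2) - μ ^ 2) ≤
      tilt p N (c * μ) := by
    intro μ _
    have := exp_le_tilt h1 N hS (c * μ)
    rw [← hn, ← hsq μ] at this
    convert this using 3
    ring
  rcases eq_or_lt_of_le hS with h2 | h3
  · refine exp_le_mix (d := 1) hN (Or.inl ⟨rfl, ?_⟩) hL hK rfl (by positivity) hε hJ fun μ _ => ?_
    · rw [← h2]; norm_num
    · have := exp_log_cosh_le_tilt_of_two h1 N h2.symm (u := c * μ)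
      rw [← hn, ← hsq μ] at this
      convert this using 5
      ring_nf
  · refine exp_le_mix (d := Fintype.card S) hN (admissible_of_three_le h3) hL hK rfl
      (by positivity) hε hJ fun μ _ => ?_
    have := exp_log_cosh_le_tilt h1 N hS (u := c * μ)
    rw [← hn, ← hsq μ] at this
    convert this using 5
    ring_nf

/-! ### Mixing preserves the supermartingale property -/

theorem measurable_mix {E : ℝ → ℝ} (hE : Continuous E) : Measurable (mix E) := by
  have h1 : Measurable fun x => ENNReal.ofReal (2 / 3 * E x) := by
    have := hE.measurable
    fun_prop
  refine h1.add ?_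
  refine Measurable.lintegral_prod_right' (f := fun q : ℝ × ℝ =>
    ENNReal.ofReal (1 / 3 / q.2 ^ 2 * E (q.1 * q.2))) ?_
  have := hE.measurable
  fun_prop

theorem sum_mul_mix_le {ι : Type*} (s : Finset ι) {w : ι → ℝ} (hw : ∀ i, 0 ≤ w i)
    {E : ι → ℝ → ℝ} {E₀ : ℝ → ℝ} (hE : ∀ i, Continuous (E i)) (h0 : ∀ i u, 0 ≤ E i u)
    (h : ∀ u, ∑ i ∈ s, w i * E i u ≤ E₀ u) (x : ℝ) :
    ∑ i ∈ s, ENNReal.ofReal (w i) * mix (E i) x ≤ mix E₀ x := by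
  simp only [mix, mul_add, Finset.sum_add_distrib]
  refine add_le_add ?_ ?_
  · simp_rw [← ENNReal.ofReal_mul (hw _)]
    rw [← ENNReal.ofReal_sum_of_nonneg fun i _ => by have := hw i; have := h0 i x; positivity]
    refine ENNReal.ofReal_le_ofReal ?_
    have := h x
    calc _ = 2 / 3 * ∑ i ∈ s, w i * E i x := by
          rw [Finset.mul_sum]; exact Finset.sum_congr rfl fun i _ => by ring
      _ ≤ _ := by linarith
  · have hm : ∀ i, Measurable fun t => ENNReal.ofReal (1 / 3 / t ^ 2 * E i (x * t)) := by
      intro i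
      have := (hE i).measurable
      fun_prop
    simp_rw [← lintegral_const_mul _ (hm _)]
    rw [← lintegral_finsetSum _ fun i _ => (hm i).const_mul _]
    refine lintegral_mono fun t => ?_
    simp only
    simp_rw [← ENNReal.ofReal_mul (hw _)]
    rw [← ENNReal.ofReal_sum_of_nonneg fun i _ => by
      have := hw i; have := h0 i (x * t); positivity]
    refine ENNReal.ofReal_le_ofReal ?_
    calc _ = 1 / 3 / t ^ 2 * ∑ i ∈ s, w i * E i (x * t) := by
          rw [Finset.mul_sum]; exact Finset.sum_congr rfl fun i _ => by ring
      _ ≤ _ := mul_le_mul_of_nonneg_left (h _) (by positivity)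

theorem mix_one (x : ℝ) : mix (fun _ => 1) x = 1 := by
  have h : ∫⁻ t in Set.Ioi (1 : ℝ), ENNReal.ofReal (1 / 3 / t ^ 2 * 1) = ENNReal.ofReal (1 / 3) := by
    have hi := integrableOn_Ioi_rpow_of_lt (a := -2) (by norm_num) one_pos
    have hv := integral_Ioi_rpow_of_lt (a := -2) (by norm_num) one_pos
    rw [← ofReal_integral_eq_lintegral_ofReal]
    · congr 1
      have : ∫ t in Set.Ioi (1 : ℝ), 1 / 3 / t ^ 2 * 1 = ∫ t in Set.Ioi (1 : ℝ), 1 / 3 * t ^ (-2 : ℝ) := by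
        refine setIntegral_congr_fun measurableSet_Ioi fun t ht => ?_
        have ht0 : (0 : ℝ) < t := lt_trans one_pos ht
        rw [Real.rpow_neg ht0.le, Real.rpow_two]
        field_simp
      rw [this, integral_const_mul, hv]
      norm_num
    · refine (hi.const_mul (1 / 3)).congr ?_
      refine (ae_restrict_iff' measurableSet_Ioi).2 (Filter.Eventually.of_forall fun t ht => ?_)
      have ht0 : (0 : ℝ) < t := lt_trans one_pos ht
      simp only
      rw [Real.rpow_neg ht0.le, Real.rpow_two]
      field_simp
    · exact Filter.Eventually.of_forall fun t => by positivity
  rw [mix, h, ← ENNReal.ofReal_add (by norm_num) (by norm_num)]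
  norm_num

end Pair

/-! ### The mixture supermartingale of a class -/

/-- The half-normal weight with which the tilts are mixed. -/
noncomputable def tiltWeight (l : ℝ) : ℝ := 1 / √(2 * Real.pi) * Real.exp (-(1 / 8) * l ^ 2)

theorem tiltWeight_nonneg (l : ℝ) : 0 ≤ tiltWeight l := by unfold tiltWeight; positivity

theorem continuous_tiltWeight : Continuous tiltWeight := by unfold tiltWeight; fun_prop

theorem lintegral_tiltWeight :
    ∫⁻ l in Set.Ioi (0 : ℝ), ENNReal.ofReal (tiltWeight l) = 1 := by
  rw [← ofReal_integral_eq_lintegral_ofReal]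
  · simp only [tiltWeight]
    rw [integral_const_mul, integral_gaussian_Ioi]
    have : √(Real.pi / (1 / 8)) / 2 = √(2 * Real.pi) := by
      rw [show Real.pi / (1 / 8) = 2 ^ 2 * (2 * Real.pi) by ring, Real.sqrt_mul (by norm_num),
        Real.sqrt_sq (by norm_num)]
      ring
    rw [this, one_div, inv_mul_cancel₀ (by positivity), ENNReal.ofReal_one]
  · exact ((integrable_exp_neg_mul_sq (by norm_num)).const_mul _).integrableOn
  · exact Filter.Eventually.of_forall tiltWeight_nonneg

section Family

variable {S Z : Type*} [Fintype S] [DecidableEq S]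

/-- The mixture supermartingale of a set of pairs, as a function of the numbers of visits. -/
noncomputable def potential (c : Finset Z) (p : Z → S → ℝ) (N : Z → S → ℕ) : ENNReal :=
  ∫⁻ l in Set.Ioi (0 : ℝ), ENNReal.ofReal (tiltWeight l) * ∏ z ∈ c, mix (tilt (p z) (N z)) l

theorem properSets_nonempty (hS : 2 ≤ Fintype.card S) : (properSets S).Nonempty := by
  have : Nontrivial S := Fintype.one_lt_card_iff_nontrivial.1 hS
  obtain ⟨a, b, hab⟩ := exists_pair_ne S
  refine ⟨{a}, ?_⟩
  simp only [properSets, Finset.mem_sdiff, Finset.mem_univ, true_and, Finset.mem_insert,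
      Finset.mem_singleton, not_or]
  refine ⟨by simp, fun he => ?_⟩
  have : b ∈ ({a} : Finset S) := he ▸ Finset.mem_univ b
  exact hab (Finset.mem_singleton.1 this).symm

theorem mix_tilt_of_tot_eq_zero (hS : 2 ≤ Fintype.card S) (p : S → ℝ) {N : S → ℕ}
    (hN : tot N = 0) (l : ℝ) : mix (tilt p N) l = 1 := by
  have h : N = fun _ => 0 := by
    funext x
    exact (Finset.sum_eq_zero_iff.1 hN) x (Finset.mem_univ x)
  rw [h, funext fun u => tilt_zero p (properSets_nonempty hS) u, mix_one]

theorem potential_zero (hS : 2 ≤ Fintype.card S) (c : Finset Z) (p : Z → S → ℝ) :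
    potential c p (fun _ _ => 0) = 1 := by
  have h : ∀ z l, mix (tilt (p z) fun _ => 0) l = 1 := fun z l =>
    mix_tilt_of_tot_eq_zero hS (p z) (by simp [tot]) l
  simp only [potential, h, Finset.prod_const_one, mul_one]
  exact lintegral_tiltWeight

/-- For fixed l a transition from z changes only the factor of z, whose mean does not increase. If z
lies outside the class nothing changes and p sums to 1. -/
theorem sum_mul_potential_le [DecidableEq Z] (c : Finset Z) {p : Z → S → ℝ}
    (h0 : ∀ z x, 0 ≤ p z x) (h1 : ∀ z, ∑ x, p z x = 1) (N : Z → S → ℕ) (z : Z) :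
    ∑ x, ENNReal.ofReal (p z x) *
      potential c p (Function.update N z (N z + Pi.single x 1)) ≤ potential c p N := by
  have hm : ∀ (N : Z → S → ℕ), Measurable fun l =>
      ENNReal.ofReal (tiltWeight l) * ∏ z ∈ c, mix (tilt (p z) (N z)) l := fun N =>
    (ENNReal.measurable_ofReal.comp continuous_tiltWeight.measurable).mul
      (Finset.measurable_fun_prod _ fun z _ => measurable_mix (continuous_tilt (p z) (N z)))
  simp only [potential]
  simp_rw [← lintegral_const_mul _ (hm _)]
  rw [← lintegral_finsetSum _ fun i _ => (hm _).const_mul _]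
  refine lintegral_mono fun l => ?_
  simp only
  by_cases hz : z ∈ c
  · have hprod : ∀ x, ∏ y ∈ c, mix (tilt (p y)
        ((Function.update N z (N z + Pi.single x 1)) y)) l =
        mix (tilt (p z) (N z + Pi.single x 1)) l * ∏ y ∈ c.erase z, mix (tilt (p y) (N y)) l := by
      intro x
      rw [← Finset.mul_prod_erase c _ hz, Function.update_self]
      congr 1
      refine Finset.prod_congr rfl fun y hy => ?_
      rw [Function.update_of_ne (Finset.ne_of_mem_erase hy)]
    simp_rw [hprod]
    rw [← Finset.mul_prod_erase c _ hz]
    have := sum_mul_mix_le Finset.univ (h0 z) (fun x => continuous_tilt (p z) (N z + Pi.single x 1))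
      (fun x u => tilt_nonneg _ _ _) (fun u => sum_mul_tilt_le (h0 z) (h1 z) (N z) u) l
    calc _ = ENNReal.ofReal (tiltWeight l) * ((∑ x, ENNReal.ofReal (p z x) *
            mix (tilt (p z) (N z + Pi.single x 1)) l) *
              ∏ y ∈ c.erase z, mix (tilt (p y) (N y)) l) := by
          rw [Finset.sum_mul, Finset.mul_sum]
          exact Finset.sum_congr rfl fun x _ => by ring
      _ ≤ _ := by gcongr
  · have hprod : ∀ x, ∏ y ∈ c, mix (tilt (p y)
        ((Function.update N z (N z + Pi.single x 1)) y)) l = ∏ y ∈ c, mix (tilt (p y) (N y)) l := by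
      intro x
      refine Finset.prod_congr rfl fun y hy => ?_
      rw [Function.update_of_ne fun h => hz (by rwa [h] at hy)]
    simp_rw [hprod]
    rw [← Finset.sum_mul, ← ENNReal.ofReal_sum_of_nonneg fun x _ => h0 z x, h1 z]
    simp

theorem exp_sum_excess_le_prod {c : Finset Z} {p : Z → S → ℝ} (h1 : ∀ z, ∑ x, p z x = 1)
    (hS : 2 ≤ Fintype.card S) {L : ℝ} (hL : 0 ≤ L) {N : Z → S → ℕ} {n₁ : ℕ}
    (hN : ∀ z ∈ c, tot (N z) ≤ n₁) {l : ℝ} (hl : 0 < l)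
    (hl' : l ≤ maxTilt (Fintype.card S) L n₁) :
    ENNReal.ofReal (Real.exp (l * ∑ z ∈ c, excess (p z) L (N z))) ≤
      ∏ z ∈ c, mix (tilt (p z) (N z)) l := by
  rw [Finset.mul_sum, Real.exp_sum, ENNReal.ofReal_prod_of_nonneg fun _ _ => (Real.exp_pos _).le]
  refine Finset.prod_le_prod' fun z hz => ?_
  rcases Nat.eq_zero_or_pos (tot (N z)) with h | h
  · rw [mix_tilt_of_tot_eq_zero hS (p z) h, excess, if_pos h]
    simp
  · exact exp_excess_le_mix (h1 z) hS hL (N z) h hl (hl'.trans (maxTilt_anti hS hL (hN z hz)))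

/-- The factors are the normalisation of the half-normal weight, the atom of `mix`, the product
√(n+1) · √(8/(n+1)), and a lower bound for the integral of e^(-θ²) over [-1, 1]. -/
theorem const_ge_one : 1 ≤ 1 / √(2 * Real.pi) * (2 / 3) * (√8 * (Real.exp (-(1 / 3)) * 2)) := by
  have h1 : √8 / √(2 * Real.pi) = 2 / √Real.pi := by
    rw [show (8 : ℝ) = 2 ^ 2 * 2 by norm_num, Real.sqrt_mul (by norm_num), Real.sqrt_sq (by norm_num),
      Real.sqrt_mul (by norm_num)]
    field_simp
  have hpi : √Real.pi ≤ 1.7725 := by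
    rw [Real.sqrt_le_left (by norm_num)]
    have := Real.pi_lt_d4
    norm_num at this ⊢
    linarith
  have hpi0 : 0 < √Real.pi := Real.sqrt_pos.2 Real.pi_pos
  have he : Real.exp (1 / 3) ≤ 1.4 := by
    refine (exp_le_taylor (by norm_num) (by norm_num)).trans ?_
    norm_num
  calc (1 : ℝ) ≤ 8 / 3 / (√Real.pi * Real.exp (1 / 3)) := by
        rw [le_div_iff₀ (by positivity), one_mul]
        calc √Real.pi * Real.exp (1 / 3) ≤ 1.7725 * 1.4 := by gcongr
          _ ≤ _ := by norm_num
    _ = 4 / 3 * (2 / √Real.pi) * Real.exp (-(1 / 3)) := by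
        rw [Real.exp_neg]; field_simp; norm_num
    _ = _ := by rw [← h1]; ring

/-- Single out the most observed pair z. The other factors give exp(-l · excess(z)) at least, and
the best event in the atom of z does the rest: a Gaussian in l remains, integrated over one unit on
each side of its peak √K in the scale r. -/
theorem exp_le_potential {c : Finset Z} {p : Z → S → ℝ} (h1 : ∀ z, ∑ x, p z x = 1)
    (hS : 2 ≤ Fintype.card S) {L : ℝ} (hL : 0 ≤ L) {N : Z → S → ℕ}
    (h : 0 < ∑ z ∈ c, excess (p z) L (N z)) :
    ENNReal.ofReal (Real.exp L) ≤ potential c p N := by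
  classical
  have hc : c.Nonempty := by
    by_contra hc
    rw [Finset.not_nonempty_iff_eq_empty.1 hc] at h
    simp at h
  obtain ⟨z, hz, hmax⟩ := c.exists_max_image (fun z => tot (N z)) hc
  set n := tot (N z) with hn
  have hn1 : 1 ≤ n := by
    by_contra hn0
    have : ∑ z ∈ c, excess (p z) L (N z) = 0 := Finset.sum_eq_zero fun y hy => by
      rw [excess, if_pos]
      have := hmax y hy
      omega
    linarith
  set K := rate (Fintype.card S) L n with hK
  have hK1 : 1 ≤ K := one_le_rate hS hL hn1
  have hsK : 1 ≤ √K := Real.one_le_sqrt.2 hK1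
  have hKK : √K ^ 2 = K := Real.sq_sqrt (by linarith)
  set k : ℝ := (n : ℝ) + 1 with hk
  have hk0 : 0 < k := by positivity
  set A := Real.log (2 ^ Fintype.card S - 2) with hA
  set r : ℝ := √(8 / k) with hr
  have hr0 : 0 < r := Real.sqrt_pos.2 (by positivity)
  have hr2 : r ^ 2 * k = 8 := by rw [hr, Real.sq_sqrt (by positivity)]; field_simp
  set C : ℝ := 1 / √(2 * Real.pi) * (2 / 3) * (Real.exp (K - A) * Real.exp (-(1 / 3))) with hC
  have hC0 : 0 ≤ C := by positivity
  have hsum : -excess (p z) L (N z) ≤ ∑ y ∈ c.erase z, excess (p y) L (N y) := by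
    rw [← Finset.add_sum_erase c _ hz] at h
    linarith
  -- The random deviation of z cancels; what is left depends only on its number of observations.
  have hM : tvDev (p z) (N z) - excess (p z) L (N z) = 2 * √K / r := by
    rw [excess, if_neg (by omega), ← hn, ← hk, ← hK]
    have : √(2 * k * K) = 4 * √K / r := by
      have h4 : 2 * k * K = (4 * √K / r) ^ 2 := by
        have hr2' : r ^ 2 = 8 / k := by field_simp; exact hr2
        rw [div_pow, mul_pow, hKK, hr2']
        field_simp
        norm_num
      rw [h4, Real.sqrt_sq (by positivity)]
    rw [this]
    field_simp
    ring
  have hlow : ∀ l ∈ Set.Icc (r * (√K - 1)) (r * (√K + 1)), 0 < l →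
      C * (4 / 3 - (l / r - √K) ^ 2) ≤
        1 / √(2 * Real.pi) * (2 / 3) * Real.exp (K - A - (l / r - √K) ^ 2) := by
    intro l _ _
    -- Tangent of exp at 0; 1/3 is the mean of θ² over [-1, 1].
    have : 4 / 3 - (l / r - √K) ^ 2 ≤ Real.exp (1 / 3 - (l / r - √K) ^ 2) := by
      have := Real.add_one_le_exp (1 / 3 - (l / r - √K) ^ 2)
      linarith
    calc C * (4 / 3 - (l / r - √K) ^ 2) ≤ C * Real.exp (1 / 3 - (l / r - √K) ^ 2) :=
          mul_le_mul_of_nonneg_left this hC0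
      _ = _ := by
        rw [hC, mul_assoc, mul_assoc, ← Real.exp_add, ← Real.exp_add]
        ring_nf
  have hpoint : ∀ l, 0 < l → l ≤ r * (√K + 1) →
      ENNReal.ofReal (1 / √(2 * Real.pi) * (2 / 3) * Real.exp (K - A - (l / r - √K) ^ 2)) ≤
        ENNReal.ofReal (tiltWeight l) * ∏ z ∈ c, mix (tilt (p z) (N z)) l := by
    intro l hl hl'
    rw [← Finset.mul_prod_erase c _ hz]
    have b1 : ENNReal.ofReal (2 / 3 * Real.exp (l * tvDev (p z) (N z) - A - l ^ 2 * n / 8)) ≤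
        mix (tilt (p z) (N z)) l :=
      le_mix_of_le (mul_le_mul_of_nonneg_left (exp_le_tilt (h1 z) (N z) hS l) (by norm_num))
    have b2 := exp_sum_excess_le_prod (c := c.erase z) h1 hS hL
      (fun y hy => hmax y (Finset.mem_of_mem_erase hy)) hl hl'
    have b3 : ENNReal.ofReal (Real.exp (l * -excess (p z) L (N z))) ≤
        ∏ y ∈ c.erase z, mix (tilt (p y) (N y)) l := by
      refine le_trans (ENNReal.ofReal_le_ofReal (Real.exp_le_exp.2 ?_)) b2
      exact mul_le_mul_of_nonneg_left hsum hl.le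
    refine le_trans (le_of_eq ?_) (mul_le_mul_right (mul_le_mul' b1 b3) _)
    rw [← ENNReal.ofReal_mul (by positivity), ← ENNReal.ofReal_mul (tiltWeight_nonneg l)]
    congr 1
    rw [tiltWeight]
    -- The weight contributes l²/8, which turns n into k = n + 1 and completes the square.
    have e : K - A - (l / r - √K) ^ 2 = -(1 / 8) * l ^ 2 +
        (l * tvDev (p z) (N z) - A - l ^ 2 * n / 8 + l * -excess (p z) L (N z)) := by
      have e1 : l * tvDev (p z) (N z) + l * -excess (p z) L (N z) = 2 * √K * l / r := by
        calc _ = l * (tvDev (p z) (N z) - excess (p z) L (N z)) := by ring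
          _ = _ := by rw [hM]; ring
      have e2 : (l / r) ^ 2 = l ^ 2 * k / 8 := by
        rw [← hr2]; field_simp
      have e3 : (l / r - √K) ^ 2 = (l / r) ^ 2 - 2 * √K * l / r + K := by
        have : (l / r - √K) ^ 2 = (l / r) ^ 2 - 2 * √K * l / r + √K ^ 2 := by ring
        rw [this, hKK]
      rw [e3, e2, hk]
      linarith
    rw [e, Real.exp_add, Real.exp_add]
    ring
  have hab : r * (√K - 1) ≤ r * (√K + 1) := by gcongr; linarith
  have hint := ofReal_sub_le_lintegral (a := r * (√K - 1)) (b := r * (√K + 1))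
    (F := fun l => C * (4 / 3 * l - r * (l / r - √K) ^ 3 / 3))
    (f := fun l => C * (4 / 3 - (l / r - √K) ^ 2))
    (h := fun l => C * (4 / 3 - (l / r - √K) ^ 2)) hab
    (fun l _ => by
      have h1 : HasDerivAt (fun l => l / r - √K) (1 / r) l :=
        ((hasDerivAt_id l).div_const r).sub_const _
      refine HasDerivAt.congr_deriv ((((hasDerivAt_id l).const_mul (4 / 3)).sub
        (((h1.pow 3).const_mul r).div_const 3)).const_mul C) ?_
      push_cast
      field_simp)
    (by fun_prop) (fun _ _ => le_rfl)
  refine le_trans (ENNReal.ofReal_le_ofReal ?_) (hint.trans ?_)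
  · have e1 : r * (√K + 1) / r - √K = 1 := by field_simp; ring
    have e2 : r * (√K - 1) / r - √K = -1 := by field_simp; ring
    simp only [e1, e2]
    have e3 : Real.exp (K - A) = √k * Real.exp L := by
      have : K - A = Real.log √k + L := by
        rw [Real.log_sqrt hk0.le, hK, rate, ← hk, ← hA]; ring
      rw [this, Real.exp_add, Real.exp_log (Real.sqrt_pos.2 hk0)]
    have e4 : √k * r = √8 := by
      rw [hr, ← Real.sqrt_mul hk0.le]; congr 1; field_simp
    calc Real.exp L = Real.exp L * 1 := (mul_one _).symm
      _ ≤ Real.exp L * (1 / √(2 * Real.pi) * (2 / 3) * (√8 * (Real.exp (-(1 / 3)) * 2))) :=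
          mul_le_mul_of_nonneg_left const_ge_one (Real.exp_pos _).le
      _ = _ := by rw [hC, e3, ← e4]; ring
  · have hsub : Set.Ioc (r * (√K - 1)) (r * (√K + 1)) ⊆ Set.Ioi 0 := fun l hl =>
      lt_of_le_of_lt (mul_nonneg hr0.le (by linarith)) hl.1
    refine le_trans ?_ (lintegral_mono_set hsub)
    refine setLIntegral_mono' measurableSet_Ioc fun l hl => ?_
    exact (ENNReal.ofReal_le_ofReal (hlow l ⟨hl.1.le, hl.2⟩ (hsub hl))).trans
      (hpoint l (hsub hl) hl.2)

end Family

/-! ### Maximal inequality along a trajectory -/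

/-- The number of transitions from the pair `z` to the state `x` in the first `t` steps. -/
def transCount {S A : Type*} [DecidableEq S] [DecidableEq A] (s : ℕ → S) (a : ℕ → A) (t : ℕ)
    (z : S × A) (x : S) : ℕ :=
  ((Finset.range t).filter fun n => (s n, a n) = z ∧ s (n + 1) = x).card

theorem transCount_succ {S A : Type*} [DecidableEq S] [DecidableEq A] (s : ℕ → S) (a : ℕ → A)
    (t : ℕ) : transCount s a (t + 1) = Function.update (transCount s a t) (s t, a t)
      (transCount s a t (s t, a t) + Pi.single (s (t + 1)) 1) := by
  funext z x
  have h : transCount s a (t + 1) z x =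
      transCount s a t z x + if (s t, a t) = z ∧ s (t + 1) = x then 1 else 0 := by
    simp only [transCount, Finset.card_filter, Finset.sum_range_succ]
  rw [h]
  by_cases hz : (s t, a t) = z
  · subst hz
    rw [Function.update_self, Pi.add_apply, Pi.single_apply]
    simp [eq_comm]
  · rw [Function.update_of_ne (Ne.symm hz)]
    simp [hz]

theorem transCount_zero {S A : Type*} [DecidableEq S] [DecidableEq A] (s : ℕ → S) (a : ℕ → A) :
    transCount s a 0 = fun _ _ => 0 := by
  funext z x
  simp [transCount]

/-- P restricted to E and P with density h agree on m by the definition of conditional expectation,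
hence they integrate nonnegative m-measurable functions alike. No integrability of g is needed. -/
theorem setLIntegral_eq_of_condExp {Ω : Type*} {m mΩ : MeasurableSpace Ω} {P : Measure Ω}
    [IsProbabilityMeasure P] (hm : m ≤ mΩ) {E : Set Ω} (hE : MeasurableSet E) {h : Ω → ℝ}
    (hh : Measurable[m] h) (h0 : ∀ ω, 0 ≤ h ω)
    (hcond : P[Set.indicator E (fun _ => (1 : ℝ)) | m] =ᵐ[P] h) {g : Ω → ENNReal}
    (hg : Measurable[m] g) :
    ∫⁻ ω in E, g ω ∂P = ∫⁻ ω, ENNReal.ofReal (h ω) * g ω ∂P := by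
  have hh' : Measurable fun ω => ENNReal.ofReal (h ω) := (hh.mono hm le_rfl).ennreal_ofReal
  have hint : Integrable (Set.indicator E (fun _ => (1 : ℝ))) P :=
    (integrable_const 1).indicator hE
  have hhint : Integrable h P := integrable_condExp.congr hcond
  have key : (P.restrict E).trim hm = (P.withDensity fun ω => ENNReal.ofReal (h ω)).trim hm := by
    refine @Measure.ext _ m _ _ fun B hB => ?_
    rw [trim_measurableSet_eq hm hB, trim_measurableSet_eq hm hB, Measure.restrict_apply (hm B hB),
      withDensity_apply _ (hm B hB)]
    have h1 := setIntegral_condExp hm hint hB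
    rw [setIntegral_congr_ae (hm B hB) (hcond.mono fun ω hω _ => hω),
      setIntegral_indicator hE, setIntegral_const, smul_eq_mul, mul_one] at h1
    rw [← ofReal_integral_eq_lintegral_ofReal hhint.integrableOn
      (Filter.Eventually.of_forall h0), h1, ofReal_measureReal]
  rw [← lintegral_trim hm hg, key, lintegral_trim hm hg,
    lintegral_withDensity_eq_lintegral_mul _ hh' (hg.mono hm le_rfl)]
  rfl

theorem IsInteraction.measurable_pair {S A Ω : Type*} [Fintype S] [MeasurableSpace S]
    [MeasurableSpace A] {mΩ : MeasurableSpace Ω} {P : Measure Ω} {M : MDP S A}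
    {ℱ : Filtration ℕ mΩ} {s : ℕ → Ω → S} {a : ℕ → Ω → A} {r : ℕ → Ω → ℝ}
    (hI : IsInteraction M P ℱ s a r) (n : ℕ) :
    Measurable[ℱ n] fun ω => (s n ω, a n ω) :=
  Measurable.prodMk (hI.state_meas n) (hI.action_meas n)

theorem IsInteraction.condExp_state {S A Ω : Type*} [Fintype S] [MeasurableSpace S]
    [MeasurableSpace A] {mΩ : MeasurableSpace Ω} {P : Measure Ω} {M : MDP S A}
    {ℱ : Filtration ℕ mΩ} {s : ℕ → Ω → S} {a : ℕ → Ω → A} {r : ℕ → Ω → ℝ}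
    (hI : IsInteraction M P ℱ s a r) (n : ℕ) (x : S) :
    P[Set.indicator {ω | s (n + 1) ω = x} (fun _ => (1 : ℝ)) | ℱ n] =ᵐ[P]
      fun ω => M.p (s n ω, a n ω) x := by
  have h := hI.law n x Set.univ MeasurableSet.univ
  have e : {ω | r n ω ∈ Set.univ ∧ s (n + 1) ω = x} = {ω | s (n + 1) ω = x} := by
    ext ω; simp
  rw [e] at h
  refine h.trans (Filter.Eventually.of_forall fun ω => ?_)
  have := M.prob (s n ω, a n ω)
  simp

section Trajectory

variable {S A Ω : Type*} [Fintype S] [DecidableEq S] [MeasurableSpace S]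
  [MeasurableSingletonClass S] [DecidableEq A] [MeasurableSpace A]
  [MeasurableSingletonClass A] {mΩ : MeasurableSpace Ω} {P : Measure Ω} {M : MDP S A} {ℱ : Filtration ℕ mΩ} {s : ℕ → Ω → S} {a : ℕ → Ω → A}
  {r : ℕ → Ω → ℝ}

theorem IsInteraction.measurable_transCount (hI : IsInteraction M P ℱ s a r) (t : ℕ) :
    Measurable[ℱ t] fun ω => transCount (fun n => s n ω) (fun n => a n ω) t := by
  refine @measurable_pi_lambda _ _ _ (ℱ t) _ _ fun z => @measurable_pi_lambda _ _ _ (ℱ t) _ _ fun x => ?_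
  simp only [transCount, Finset.card_filter]
  refine Finset.measurable_fun_sum _ fun n hn => ?_
  have hn' : n + 1 ≤ t := Finset.mem_range.1 hn
  have h1 : Measurable[ℱ t] fun ω => (s n ω, a n ω) :=
    (hI.measurable_pair n).mono (ℱ.mono (by omega)) le_rfl
  have h2 : Measurable[ℱ t] (s (n + 1)) := (hI.state_meas (n + 1)).mono (ℱ.mono hn') le_rfl
  refine Measurable.ite ?_ measurable_const measurable_const
  exact (h1 (measurableSet_singleton z)).inter (h2 (measurableSet_singleton x))

variable [Fintype A] [IsProbabilityMeasure P]

/-- Splitting over the next state replaces its indicator by its conditional probability; `hV` then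
applies pointwise at the current counts and pair. Localising to events of ℱ t expresses the
conditional inequality without integrability. -/
theorem IsInteraction.setLIntegral_succ_le (hI : IsInteraction M P ℱ s a r)
    {V : (S × A → S → ℕ) → ENNReal}
    (hV : ∀ N z, ∑ x, ENNReal.ofReal (M.p z x) *
      V (Function.update N z (N z + Pi.single x 1)) ≤ V N) (t : ℕ) {B : Set Ω}
    (hB : MeasurableSet[ℱ t] B) :
    ∫⁻ ω in B, V (transCount (fun n => s n ω) (fun n => a n ω) (t + 1)) ∂P ≤
      ∫⁻ ω in B, V (transCount (fun n => s n ω) (fun n => a n ω) t) ∂P := by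
  have hle := ℱ.le t
  have hN := hI.measurable_transCount t
  have hz := hI.measurable_pair t
  set N := fun ω => transCount (fun n => s n ω) (fun n => a n ω) t with hNdef
  set z := fun ω => (s t ω, a t ω) with hzdef
  have hw : Measurable[ℱ t] fun ω => (N ω, z ω) := Measurable.prodMk hN hz
  let G : S → Ω → ENNReal := fun x =>
    B.indicator fun ω => V (Function.update (N ω) (z ω) (N ω (z ω) + Pi.single x 1))
  have hG : ∀ x, Measurable[ℱ t] (G x) := fun x => by
    have h : Measurable[ℱ t] fun ω =>
        V (Function.update (N ω) (z ω) (N ω (z ω) + Pi.single x 1)) := by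
      -- Counts and pairs range over a countable discrete space, so V needs no measurability
      -- hypothesis.
      have hF : Measurable fun w : (S × A → S → ℕ) × (S × A) =>
        V (Function.update w.1 w.2 (w.1 w.2 + Pi.single x 1)) := Measurable.of_discrete
      exact hF.comp hw
    exact h.indicator hB
  have hE : ∀ x, MeasurableSet {ω | s (t + 1) ω = x} := fun x =>
    ((hI.state_meas (t + 1)).mono (ℱ.le _) le_rfl) (measurableSet_singleton x)
  have hstep : ∀ x, ∫⁻ ω in {ω | s (t + 1) ω = x}, G x ω ∂P =
      ∫⁻ ω, ENNReal.ofReal (M.p (z ω) x) * G x ω ∂P := fun x =>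
    setLIntegral_eq_of_condExp hle (hE x)
      ((Measurable.of_discrete (f := fun y => (M.p y : S → ℝ) x)).comp hz)
      (fun ω => (M.p (z ω)).2.1 x) (hI.condExp_state t x) (hG x)
  rw [← lintegral_indicator (hle B hB), ← lintegral_indicator (hle B hB)]
  calc _ = ∫⁻ ω, ∑ x, {ω | s (t + 1) ω = x}.indicator (G x) ω ∂P := by
        refine lintegral_congr fun ω => ?_
        have hind : ∀ x, {ω | s (t + 1) ω = x}.indicator (G x) ω =
            if s (t + 1) ω = x then G x ω else 0 := fun x => by
          rw [Set.indicator_apply]; rfl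
        simp_rw [hind]
        rw [Finset.sum_ite_eq, if_pos (Finset.mem_univ _)]
        simp only [G, transCount_succ]
        rfl
    _ = ∑ x, ∫⁻ ω in {ω | s (t + 1) ω = x}, G x ω ∂P := by
        rw [lintegral_finsetSum _ fun x _ => ((hG x).mono hle le_rfl).indicator (hE x)]
        exact Finset.sum_congr rfl fun x _ => lintegral_indicator (hE x) _
    _ = ∫⁻ ω, ∑ x, ENNReal.ofReal (M.p (z ω) x) * G x ω ∂P := by
        rw [lintegral_finsetSum]
        · exact Finset.sum_congr rfl fun x _ => hstep x
        · intro x _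
          refine Measurable.mul ?_ ((hG x).mono hle le_rfl)
          exact ((Measurable.of_discrete (f := fun y => ENNReal.ofReal ((M.p y : S → ℝ) x))).comp
            (hz.mono hle le_rfl))
    _ ≤ _ := by
        refine lintegral_mono fun ω => ?_
        by_cases hω : ω ∈ B
        · simp only [G, Set.indicator_of_mem hω]
          exact hV (N ω) (z ω)
        · simp [G, Set.indicator_of_notMem hω]

/-- Ville's inequality for a function of the transition counts. -/
theorem IsInteraction.measure_exists_le (hI : IsInteraction M P ℱ s a r)
    {V : (S × A → S → ℕ) → ENNReal}
    (hV : ∀ N z, ∑ x, ENNReal.ofReal (M.p z x) *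
      V (Function.update N z (N z + Pi.single x 1)) ≤ V N) (h0 : V (fun _ _ => 0) ≤ 1)
    (R : ENNReal) :
    R * P {ω | ∃ t, R ≤ V (transCount (fun n => s n ω) (fun n => a n ω) t)} ≤ 1 := by
  set X : ℕ → Ω → ENNReal := fun t ω => V (transCount (fun n => s n ω) (fun n => a n ω) t) with hX
  have hXm : ∀ t, Measurable[ℱ t] (X t) := fun t =>
    (Measurable.of_discrete (f := V)).comp (hI.measurable_transCount t)
  set D : ℕ → Set Ω := fun t => {ω | ∃ i ≤ t, R ≤ X i ω} with hD
  have hDm : ∀ t, MeasurableSet[ℱ t] (D t) := by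
    intro t
    have : D t = ⋃ i ∈ Finset.range (t + 1), {ω | R ≤ X i ω} := by
      ext ω; simp [hD]
    rw [this]
    refine @Finset.measurableSet_biUnion _ _ (ℱ t) _ _ fun i hi => ?_
    exact ℱ.mono (Nat.lt_succ_iff.1 (Finset.mem_range.1 hi)) _ (hXm i measurableSet_Ici)
  have hDm' : ∀ t, MeasurableSet (D t) := fun t => ℱ.le t _ (hDm t)
  -- The invariant is the mean of the process stopped at its first crossing of R, with its value
  -- there replaced by R.
  have main : ∀ t, R * P (D t) + ∫⁻ ω in (D t)ᶜ, X t ω ∂P ≤ 1 := by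
    intro t
    induction t with
    | zero =>
      have hconst : ∀ ω, X 0 ω ≤ 1 := fun ω => by
        simp only [hX, transCount_zero]; exact h0
      calc R * P (D 0) + ∫⁻ ω in (D 0)ᶜ, X 0 ω ∂P
          ≤ ∫⁻ ω in D 0, X 0 ω ∂P + ∫⁻ ω in (D 0)ᶜ, X 0 ω ∂P := by
            gcongr
            rw [← setLIntegral_const]
            refine setLIntegral_mono' (hDm' 0) fun ω hω => ?_
            obtain ⟨i, hi, hR⟩ := hω
            rwa [Nat.le_zero.1 hi] at hR
        _ = ∫⁻ ω, X 0 ω ∂P := lintegral_add_compl _ (hDm' 0)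
        _ ≤ ∫⁻ _, 1 ∂P := lintegral_mono hconst
        _ = 1 := by simp
    | succ t ih =>
      have hsub : D t ⊆ D (t + 1) := fun ω ⟨i, hi, hR⟩ => ⟨i, by omega, hR⟩
      have hXR : ∀ ω ∈ D (t + 1) \ D t, R ≤ X (t + 1) ω := by
        rintro ω ⟨⟨i, hi, hR⟩, hn⟩
        rcases Nat.lt_or_ge t i with h | h
        · rwa [show i = t + 1 by omega] at hR
        · exact absurd ⟨i, h, hR⟩ hn
      have hdm : MeasurableSet (D (t + 1) \ D t) := (hDm' _).diff (hDm' _)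
      have e1 : P (D (t + 1)) = P (D t) + P (D (t + 1) \ D t) := by
        rw [← measure_union Set.disjoint_sdiff_right hdm, Set.union_sdiff_cancel hsub]
      have e2 : (D t)ᶜ = (D (t + 1) \ D t) ∪ (D (t + 1))ᶜ := by
        ext ω
        have := @hsub ω
        simp only [Set.mem_compl_iff, Set.mem_union, Set.mem_sdiff]
        tauto
      calc R * P (D (t + 1)) + ∫⁻ ω in (D (t + 1))ᶜ, X (t + 1) ω ∂P
          = R * P (D t) + (R * P (D (t + 1) \ D t) + ∫⁻ ω in (D (t + 1))ᶜ, X (t + 1) ω ∂P) := by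
            rw [e1, mul_add, add_assoc]
        _ ≤ R * P (D t) + (∫⁻ ω in D (t + 1) \ D t, X (t + 1) ω ∂P +
              ∫⁻ ω in (D (t + 1))ᶜ, X (t + 1) ω ∂P) := by
            gcongr
            rw [← setLIntegral_const]
            exact setLIntegral_mono' hdm hXR
        _ = R * P (D t) + ∫⁻ ω in (D t)ᶜ, X (t + 1) ω ∂P := by
            rw [e2, lintegral_union (hDm' _).compl]
            exact Set.disjoint_left.2 fun ω h1 h2 => h2 h1.1
        _ ≤ R * P (D t) + ∫⁻ ω in (D t)ᶜ, X t ω ∂P := by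
            gcongr R * P (D t) + ?_
            exact hI.setLIntegral_succ_le hV t (hDm t).compl
        _ ≤ 1 := ih
  have hU : {ω | ∃ t, R ≤ X t ω} = ⋃ t, D t := by
    ext ω
    simp only [Set.mem_ofPred_eq, Set.mem_iUnion, hD]
    exact ⟨fun ⟨t, h⟩ => ⟨t, t, le_rfl, h⟩, fun ⟨_, i, _, h⟩ => ⟨i, h⟩⟩
  have hmono : Monotone D := fun i j hij ω ⟨k, hk, hR⟩ => ⟨k, hk.trans hij, hR⟩
  rw [hU, hmono.measure_iUnion, ENNReal.mul_iSup]
  exact iSup_le fun t => le_self_add.trans (main t)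

end Trajectory

/-! ### Rearrangements -/

section Rearrangement

variable {S : Type*} [Fintype S]

/-- Pigeonhole: the first i + 1 states in the order of f cannot all sit among the first i in the
order of m. -/
theorem IsProfile.le_of_le {f m : S → ℝ} {σ ρ : Fin (Fintype.card S) ≃ S} (hf : IsProfile f σ)
    (hm : IsProfile m ρ) (h : ∀ x, f x ≤ m x) (i : Fin (Fintype.card S)) :
    f (σ i) ≤ m (ρ i) := by
  obtain ⟨j, hj, hij⟩ : ∃ j ≤ i, i ≤ ρ.symm (σ j) := by
    by_contra hc
    push Not at hc
    have hcard := Finset.card_le_card_of_injOn (s := Finset.Iic i) (t := Finset.Iio i)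
      (fun j => ρ.symm (σ j)) (fun j hj => by simpa using hc j (by simpa using hj))
      (fun x _ y _ hxy => σ.injective (ρ.symm.injective hxy))
    simp at hcard
  calc f (σ i) ≤ f (σ j) := hf hj
    _ ≤ m (σ j) := h _
    _ = m (ρ (ρ.symm (σ j))) := by simp
    _ ≤ m (ρ i) := hm hij

/-- Sorting is nonexpansive for the `ℓ¹` distance. -/
theorem IsProfile.sum_abs_sub_le {f h : S → ℝ} {σ τ : Fin (Fintype.card S) ≃ S}
    (hf : IsProfile f σ) (hh : IsProfile h τ) :
    ∑ i, |f (σ i) - h (τ i)| ≤ ∑ x, |f x - h x| := by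
  -- As |a - b| = 2 max(a, b) - a - b and sorting preserves the sums of f and h, only the sums of
  -- maxima need comparing. Both sorted functions lie below the sorted maximum.
  obtain ⟨ρ, hρ⟩ := exists_isProfile fun x => max (f x) (h x)
  have hmax : ∑ i, max (f (σ i)) (h (τ i)) ≤ ∑ x, max (f x) (h x) := by
    rw [← ρ.sum_comp fun x => max (f x) (h x)]
    exact Finset.sum_le_sum fun i _ => max_le (hf.le_of_le hρ (fun x => le_max_left _ _) i)
      (hh.le_of_le hρ (fun x => le_max_right _ _) i)
  have habs : ∀ a b : ℝ, |a - b| = 2 * max a b - a - b := by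
    intro a b
    rcases le_total a b with h | h
    · rw [max_eq_right h, abs_of_nonpos (by linarith)]; ring
    · rw [max_eq_left h, abs_of_nonneg (by linarith)]; ring
  simp_rw [habs, Finset.sum_sub_distrib, ← Finset.mul_sum]
  rw [σ.sum_comp f, τ.sum_comp h]
  linarith

theorem IsProfile.const_mul {f : S → ℝ} {σ : Fin (Fintype.card S) ≃ S} (hf : IsProfile f σ)
    {c : ℝ} (hc : 0 ≤ c) : IsProfile (fun x => c * f x) σ := fun _ _ hij =>
  mul_le_mul_of_nonneg_left (hf hij) hc

theorem dev_of_card_le_one {p : S → ℝ} (h1 : ∑ x, p x = 1) (hS : ¬ 2 ≤ Fintype.card S)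
    (N : S → ℕ) (x : S) : dev p N x = 0 := by
  have hsub : Subsingleton S := Fintype.card_le_one_iff_subsingleton.1 (by omega)
  have hu : (Finset.univ : Finset S) = {x} :=
    Finset.eq_singleton_iff_unique_mem.2 ⟨Finset.mem_univ x, fun y _ => Subsingleton.elim y x⟩
  rw [hu, Finset.sum_singleton] at h1
  rw [dev, tot, hu, Finset.sum_singleton, h1]
  simp

end Rearrangement

/-! ### From the excess of a class to the confidence set -/

section Reduction

variable {S A : Type*} [Fintype S] [DecidableEq S] [DecidableEq A]

theorem tot_transCount (s : ℕ → S) (a : ℕ → A) (t : ℕ) (z : S × A) :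
    tot (transCount s a t z) = count s a t z := by
  simp only [tot, transCount, count, Finset.card_filter]
  rw [Finset.sum_comm]
  refine Finset.sum_congr rfl fun n _ => ?_
  by_cases h : (s n, a n) = z <;> simp [h]

theorem count_mul_empDist (s : ℕ → S) (a : ℕ → A) (t : ℕ) (z : S × A) (x : S) :
    (count s a t z : ℝ) * empDist s a t z x = transCount s a t z x := by
  unfold empDist
  rcases Nat.eq_zero_or_pos (count s a t z) with h | h
  · have h1 := tot_transCount s a t z
    rw [h] at h1
    have h2 := (Finset.sum_eq_zero_iff.1 h1) x (Finset.mem_univ x)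
    rw [h2, h]
    simp
  · have : (count s a t z : ℝ) ≠ 0 := by exact_mod_cast h.ne'
    rw [mul_div_cancel₀ _ this]
    rfl

/-- Identifies the radius with the bound in `excess` for L = -log δ, up to the factor 1/2 of total
variation. -/
theorem mul_weissman {k n : ℕ} {δ : ℝ} (hk : 2 ≤ k) (hn : n ≠ 0) (hδ : 0 < δ) :
    (n : ℝ) * weissman k n δ = √(2 * (n + 1) * rate k (-Real.log δ) n) := by
  have hn0 : (0 : ℝ) < n := by exact_mod_cast Nat.pos_of_ne_zero hn
  have h2 : (0 : ℝ) < 2 ^ k - 2 := by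
    have : (2 : ℝ) ^ 2 ≤ 2 ^ k := pow_le_pow_right₀ (by norm_num) hk
    linarith
  have hlog : Real.log (√((n : ℝ) + 1) * ((2 ^ k - 2) / δ)) = rate k (-Real.log δ) n := by
    rw [Real.log_mul (by positivity) (by positivity), Real.log_sqrt (by positivity),
      Real.log_div h2.ne' hδ.ne', rate]
    ring
  unfold weissman
  rw [hlog]
  have e : (n : ℝ) = √((n : ℝ) ^ 2) := (Real.sqrt_sq hn0.le).symm
  nth_rewrite 1 [e]
  rw [← Real.sqrt_mul (by positivity)]
  congr 1
  field_simp

/-- The deviations of a class are within its radius if its total excess is not positive. -/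
theorem sum_sum_abs_dev_le {c : Finset (S × A)} {p : S × A → S → ℝ} (h1 : ∀ z, ∑ x, p z x = 1)
    {s : ℕ → S} {a : ℕ → A} {t : ℕ} {δ : ℝ} (hδ : 0 < δ)
    (h : 2 ≤ Fintype.card S →
      ∑ z ∈ c, excess (p z) (-Real.log δ) (transCount s a t z) ≤ 0) :
    ∑ z ∈ c, ∑ x, |dev (p z) (transCount s a t z) x| ≤
      ∑ z ∈ c, (count s a t z : ℝ) * weissman (Fintype.card S) (count s a t z) δ := by
  by_cases hS : 2 ≤ Fintype.card S
  · have key : ∀ z ∈ c, ∑ x, |dev (p z) (transCount s a t z) x| -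
        (count s a t z : ℝ) * weissman (Fintype.card S) (count s a t z) δ =
          2 * excess (p z) (-Real.log δ) (transCount s a t z) := by
      intro z _
      rw [excess, tot_transCount]
      split_ifs with h0
      · have hz : ∀ x, dev (p z) (transCount s a t z) x = 0 := by
          intro x
          have h2 := tot_transCount s a t z
          rw [h0] at h2
          have h3 := (Finset.sum_eq_zero_iff.1 h2) x (Finset.mem_univ x)
          simp [dev, h2, h3]
        simp [hz, h0]
      · rw [mul_weissman hS h0 hδ, tvDev]
        ring
    have := h hS
    have h2 := Finset.sum_congr rfl key
    rw [Finset.sum_sub_distrib, ← Finset.mul_sum] at h2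
    linarith
  · simp only [dev_of_card_le_one (h1 _) hS, abs_zero, Finset.sum_const_zero]
    exact Finset.sum_nonneg fun z _ => mul_nonneg (Nat.cast_nonneg _) (Real.sqrt_nonneg _)

/-- All sorted laws of the class equal g, so g is their weighted average. The triangle inequality
separates the pairs, and nonexpansiveness of sorting removes the profiles of each. -/
theorem sum_abs_aggDist_sub_le {c : Finset (S × A)} {p : S × A → S → ℝ}
    {s : ℕ → S} {a : ℕ → A} {t : ℕ} {σ τ : S × A → (Fin (Fintype.card S) ≃ S)}
    {g : Fin (Fintype.card S) → ℝ} (hσ : ∀ z, IsProfile (empDist s a t z) (σ z))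
    (hτ : ∀ z, IsProfile (p z) (τ z)) (hg : ∀ z ∈ c, ∀ i, p z (τ z i) = g i)
    (hc : 0 < classCount s a t c) :
    ∑ i, |aggDist s a t σ c i - g i| ≤
      1 / (classCount s a t c : ℝ) * ∑ z ∈ c, ∑ x, |dev (p z) (transCount s a t z) x| := by
  have hc0 : (0 : ℝ) < classCount s a t c := by exact_mod_cast hc
  have hi : ∀ i, |aggDist s a t σ c i - g i| ≤ 1 / (classCount s a t c : ℝ) *
      ∑ z ∈ c, |(count s a t z : ℝ) * empDist s a t z (σ z i) - count s a t z * p z (τ z i)| := by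
    intro i
    have e : aggDist s a t σ c i - g i = 1 / (classCount s a t c : ℝ) *
        ∑ z ∈ c, ((count s a t z : ℝ) * empDist s a t z (σ z i) -
          count s a t z * p z (τ z i)) := by
      have hsum : ∑ z ∈ c, (count s a t z : ℝ) * p z (τ z i) = classCount s a t c * g i := by
        rw [classCount, Nat.cast_sum, Finset.sum_mul]
        exact Finset.sum_congr rfl fun z hz => by rw [hg z hz]
      rw [Finset.sum_sub_distrib, hsum, mul_sub, aggDist]
      field_simp
    rw [e, abs_mul, abs_of_nonneg (by positivity)]
    exact mul_le_mul_of_nonneg_left (Finset.abs_sum_le_sum_abs _ _) (by positivity)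
  refine (Finset.sum_le_sum fun i _ => hi i).trans ?_
  rw [← Finset.mul_sum, Finset.sum_comm]
  refine mul_le_mul_of_nonneg_left (Finset.sum_le_sum fun z _ => ?_) (by positivity)
  refine (((hσ z).const_mul (Nat.cast_nonneg (count s a t z))).sum_abs_sub_le
    ((hτ z).const_mul (Nat.cast_nonneg (count s a t z)))).trans (le_of_eq ?_)
  refine Finset.sum_congr rfl fun x _ => ?_
  rw [count_mul_empDist, dev, tot_transCount]

theorem MDP.profile_eq_of_mem_classes [Fintype A] (M : MDP S A) {c : Finset (S × A)}
    (hc : c ∈ M.classes.parts) {y z : S × A} (hy : y ∈ c) (hz : z ∈ c)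
    {σ τ : Fin (Fintype.card S) ≃ S} (hσ : IsProfile (M.p y) σ) (hτ : IsProfile (M.p z) τ)
    (i : Fin (Fintype.card S)) : M.p y (σ i) = M.p z (τ i) := by
  have hrel : M.Similar 0 0 y z := by
    let : DecidableRel M.setoid.r := Classical.decRel _
    have h : z ∈ M.classes.part y := by rw [M.classes.part_eq_of_mem hc hy]; exact hz
    exact Finpartition.mem_part_ofSetoid_iff_rel.1 h
  have h0 := hrel.1 σ τ hσ hτ
  have h1 := (Finset.sum_eq_zero_iff_of_nonneg fun i _ => abs_nonneg _).1
    (le_antisymm h0 (Finset.sum_nonneg fun i _ => abs_nonneg _)) i (Finset.mem_univ i)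
  exact sub_eq_zero.1 (abs_eq_zero.1 h1)

theorem mem_confSet_of_sum_excess_nonpos [Fintype A] (M : MDP S A) {s : ℕ → S} {a : ℕ → A}
    {t : ℕ} {σ : S × A → (Fin (Fintype.card S) ≃ S)}
    (hσ : ∀ z, IsProfile (empDist s a t z) (σ z)) {δ : ℝ} (hδ : 0 < δ)
    (h : 2 ≤ Fintype.card S → ∀ c ∈ M.classes.parts, ∑ z ∈ c, excess (M.p z)
      (-Real.log (δ / (M.classes.parts.card : ℝ))) (transCount s a t z) ≤ 0) :
    M.p ∈ confSet M.classes s a σ t δ := by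
  intro c hc
  choose τ hτ using fun z => exists_isProfile (M.p z : S → ℝ)
  obtain ⟨y, hy⟩ := M.classes.nonempty_of_mem_parts hc
  refine ⟨fun i => M.p y (τ y i), fun z hz ρ hρ i =>
    M.profile_eq_of_mem_classes hc hz hy hρ (hτ y) i, fun hcount => ?_⟩
  have hC : (0 : ℝ) < M.classes.parts.card := by exact_mod_cast Finset.card_pos.2 ⟨c, hc⟩
  refine (sum_abs_aggDist_sub_le (p := fun z => M.p z) hσ hτ
    (fun z hz i => M.profile_eq_of_mem_classes hc hz hy (hτ z) (hτ y) i) hcount).trans ?_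
  refine mul_le_mul_of_nonneg_left ?_ (by positivity)
  exact sum_sum_abs_dev_le (fun z => (M.p z).2.2) (div_pos hδ hC) fun hS => h hS c hc

end Reduction

/-- The excess of a class becomes positive with a small probability only. -/
theorem IsInteraction.measure_exists_sum_excess_pos_le {S A Ω : Type*} [Fintype S]
    [DecidableEq S] [MeasurableSpace S] [MeasurableSingletonClass S] [Fintype A] [DecidableEq A]
    [MeasurableSpace A] [MeasurableSingletonClass A] {mΩ : MeasurableSpace Ω} {P : Measure Ω}
    [IsProbabilityMeasure P] {M : MDP S A} {ℱ : Filtration ℕ mΩ} {s : ℕ → Ω → S} {a : ℕ → Ω → A}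
    {r : ℕ → Ω → ℝ} (hI : IsInteraction M P ℱ s a r) (hS : 2 ≤ Fintype.card S)
    (c : Finset (S × A)) {δ : ℝ} (h0 : 0 < δ) (h1 : δ ≤ 1) :
    P {ω | ∃ t, 0 < ∑ z ∈ c, excess (M.p z) (-Real.log δ)
      (transCount (fun n => s n ω) (fun n => a n ω) t z)} ≤ ENNReal.ofReal δ := by
  have hL : 0 ≤ -Real.log δ := neg_nonneg.2 (Real.log_nonpos h0.le h1)
  have hp1 : ∀ z, ∑ x, (M.p z : S → ℝ) x = 1 := fun z => (M.p z).2.2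
  have hV := hI.measure_exists_le (V := potential c fun z => M.p z)
    (sum_mul_potential_le c (fun z => (M.p z).2.1) hp1) (potential_zero hS c _).le
    (ENNReal.ofReal (Real.exp (-Real.log δ)))
  rw [Real.exp_neg, Real.exp_log h0, ENNReal.ofReal_inv_of_pos h0] at hV
  have hδ0 : ENNReal.ofReal δ ≠ 0 := (ENNReal.ofReal_pos.2 h0).ne'
  have hV' := mul_le_mul_right hV (ENNReal.ofReal δ)
  rw [← mul_assoc, ENNReal.mul_inv_cancel hδ0 ENNReal.ofReal_ne_top, one_mul, mul_one] at hV'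
  refine (measure_mono ?_).trans hV'
  rintro ω ⟨t, ht⟩
  refine ⟨t, ?_⟩
  have := exp_le_potential hp1 hS hL ht
  rwa [Real.exp_neg, Real.exp_log h0, ENNReal.ofReal_inv_of_pos h0] at this

end EquivRL

/-! ### Union bound over the classes -/

theorem mainTheorem4 {S A Ω : Type*} [Fintype S] [DecidableEq S] [MeasurableSpace S]
    [MeasurableSingletonClass S] [Fintype A] [DecidableEq A] [MeasurableSpace A]
    [MeasurableSingletonClass A] {mΩ : MeasurableSpace Ω}
    (P : MeasureTheory.Measure Ω) [MeasureTheory.IsProbabilityMeasure P]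
    (M : EquivRL.MDP S A) (ℱ : MeasureTheory.Filtration ℕ mΩ)
    (s : ℕ → Ω → S) (a : ℕ → Ω → A) (r : ℕ → Ω → ℝ)
    (hI : EquivRL.IsInteraction M P ℱ s a r)
    (σ : ℕ → Ω → S × A → (Fin (Fintype.card S) ≃ S))
    (hσ : ∀ t ω z, EquivRL.IsProfile
      (EquivRL.empDist (fun n => s n ω) (fun n => a n ω) t z) (σ t ω z))
    (δ : ℝ) (hδ₀ : 0 < δ) (hδ₁ : δ < 1) :
    ENNReal.ofReal (1 - δ) ≤
      P {ω | ∀ t : ℕ, M.p ∈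
        EquivRL.confSet M.classes (fun n => s n ω) (fun n => a n ω) (σ t ω) t δ} := by
  set C := M.classes.parts.card with hC
  set good := {ω | ∀ t : ℕ, M.p ∈
    EquivRL.confSet M.classes (fun n => s n ω) (fun n => a n ω) (σ t ω) t δ} with hgood
  set bad : Finset (S × A) → Set Ω := fun c => {ω | ∃ t, 0 < ∑ z ∈ c,
    EquivRL.excess (M.p z) (-Real.log (δ / (C : ℝ)))
      (EquivRL.transCount (fun n => s n ω) (fun n => a n ω) t z)} with hbad
  rw [ENNReal.ofReal_sub _ hδ₀.le, ENNReal.ofReal_one, tsub_le_iff_right]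
  by_cases hS : 2 ≤ Fintype.card S
  · have hcover : (Set.univ : Set Ω) ⊆ good ∪ ⋃ c ∈ M.classes.parts, bad c := by
      intro ω _
      by_cases hω : ω ∈ ⋃ c ∈ M.classes.parts, bad c
      · exact Or.inr hω
      · refine Or.inl fun t => EquivRL.mem_confSet_of_sum_excess_nonpos M (hσ t ω) hδ₀
          fun _ c hc => ?_
        by_contra hpos
        exact hω (Set.mem_biUnion hc ⟨t, not_le.1 hpos⟩)
    have hsum : P (⋃ c ∈ M.classes.parts, bad c) ≤ ENNReal.ofReal δ := by
      -- Without any pair there is no class and δ / C is a junk value, but the union is empty.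
      rcases Nat.eq_zero_or_pos C with h0 | h0
      · rw [hC, Finset.card_eq_zero] at h0
        simp [h0]
      · have hC1 : (1 : ℝ) ≤ C := by exact_mod_cast h0
        have hC0 : (0 : ℝ) < C := by linarith
        have hle : δ / (C : ℝ) ≤ 1 := by rw [div_le_one hC0]; linarith
        calc P (⋃ c ∈ M.classes.parts, bad c) ≤ ∑ c ∈ M.classes.parts, P (bad c) :=
              MeasureTheory.measure_biUnion_finset_le _ _
          _ ≤ ∑ _c ∈ M.classes.parts, ENNReal.ofReal (δ / C) :=
              Finset.sum_le_sum fun c _ =>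
                hI.measure_exists_sum_excess_pos_le hS c (div_pos hδ₀ hC0) hle
          _ = ENNReal.ofReal δ := by
              rw [Finset.sum_const, ← hC, nsmul_eq_mul, ← ENNReal.ofReal_natCast,
                ← ENNReal.ofReal_mul (by positivity)]
              congr 1
              field_simp
    calc (1 : ENNReal) = P Set.univ := MeasureTheory.measure_univ.symm
      _ ≤ P good + P (⋃ c ∈ M.classes.parts, bad c) :=
          (MeasureTheory.measure_mono hcover).trans (MeasureTheory.measure_union_le _ _)
      _ ≤ P good + ENNReal.ofReal δ := by gcongr
  -- With at most one state all deviations vanish, so the confidence set contains p surely.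
  · have huniv : good = Set.univ := Set.eq_univ_of_forall fun ω t =>
      EquivRL.mem_confSet_of_sum_excess_nonpos M (hσ t ω) hδ₀ fun h => absurd h hS
    rw [huniv, MeasureTheory.measure_univ]
    exact le_self_add
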